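/- Let $0<q<1$, let $d\ge 1$ be an integer and let $\alpha_1,\dots,\alpha_d>0$. For $\alpha>0$ let $V^{(\alpha)}$ be the vector space (over $\mathbb R$ or $\mathbb C$) with orthonormal basis $e^{(\alpha)}_n$, $n=0,1,2,\dots$, on which $su_q(1,1)$ acts by $$A_0e_n^{(\alpha)}=\Bigl(n+\tfrac{\alpha+1}2\Bigr)e_n^{(\alpha)},\qquad A_+e_n^{(\alpha)}=\sqrt{\sigma^{(\alpha)}_{n+1}}\,e_{n+1}^{(\alpha)},\qquad A_-e_n^{(\alpha)}=\sqrt{\sigma^{(\alpha)}_n}\,e_{n-1}^{(\alpha)},\qquad \sigma_n^{(\alpha)}=q^{1/2}\frac{(1-q^n)(1-q^{n+\alpha})}{(1-q)^2}.$$ Let $W=V^{(\alpha_1)}\otimes\cdots\otimes V^{(\alpha_d)}$, with orthonormal basis $e_{\boldsymbol y}=e_{y_1}^{(\alpha_1)}\otimes\cdots\otimes e_{y_d}^{(\alpha_d)}$, $\boldsymbol y\in\mathbb Z_{\ge0}^d$. Let $A_0^{(k)},A_\pm^{(k)}$ be the generators acting on the $k$-th factor, and for $1\le k\le d$ put $$A_0^{[1;k]}=\sum_{i=1}^kA_0^{(i)},\qquad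 A_\pm^{[1;k]}=\sum_{i=1}^kq^{A_0^{(1)}+\cdots+A_0^{(i-1)}}A_\pm^{(i)},$$ $$\Gamma^{[1;k]}=\frac{q^{-1/2}q^{A_0^{[1;k]}}+q^{1/2}q^{-A_0^{[1;k]}}}{(q^{1/2}-q^{-1/2})^2}-A_+^{[1;k]}A_-^{[1;k]}q^{1-A_0^{[1;k]}}.$$ Let $\gamma(a)=\dfrac{q^{a/2}+q^{-a/2}}{(q^{1/2}-q^{-1/2})^2}$, $N_k=\sum_{i\le k}n_i$, $Y_k=\sum_{i\le k}y_i$ and $A_k=\sum_{i\le k}\alpha_i$. A coupled basis is an orthonormal basis $(g_{\boldsymbol n})_{\boldsymbol n\in\mathbb Z_{\ge0}^d}$ of $W$ such that $$\Gamma^{[1;k]}g_{\boldsymbol n}=\gamma(2N_{k-1}+A_k+k-1)\,g_{\boldsymbol n}\quad(2\le k\le d),\qquad q^{A_0^{[1;d]}}g_{\boldsymbol n}=q^{N_d+(A_d+d)/2}g_{\boldsymbol n}.$$ With $(a;q)_n=\prod_{i=0}^{n-1}(1-aq^i)$ and ${}_3\phi_2$ the basic hypergeometric series, set, for integers $0\le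 n,x\le N$, $$h_n(x,\alpha,\beta,N;q)=(q^{\alpha+1};q)_n(q^{-N};q)_n\;{}_3\phi_2\left(\begin{matrix}q^{-n},\,q^{n+\alpha+\beta+1},\,q^{-x}\\ q^{\alpha+1},\,q^{-N}\end{matrix};q,q\right),$$ $$\omega(x;\alpha,\beta,N;q)=\frac{(q^{\alpha+1};q)_x(q^{\beta+1};q)_{N-x}}{(q;q)_x(q;q)_{N-x}}\,q^{(N-x)(\alpha+1)},$$ $$\eta(n,\alpha,\beta,N;q)=\frac{(q^{\alpha+\beta+2};q)_{n+N}}{(q;q)_{N-n}}\,q^{2\binom n2-2Nn}\,\frac{1-q^{\alpha+\beta+1}}{1-q^{2n+\alpha+\beta+1}}\,\frac{(q;q)_n(q^{\alpha+1};q)_n(q^{\beta+1};q)_n}{(q^{\alpha+\beta+1};q)_n}\,q^{n(\alpha+1)},$$ $$\widehat h_n(x,\alpha,\beta,N;q)=\sqrt{\frac{\omega(x;\alpha,\beta,N;q)}{\eta(n,\alpha,\beta,N;q)}}\;h_n(x,\alpha,\beta,N;q),$$ and $\widehat h_n(x,\alpha,\beta,N;q)=0$ if not both $0\le x\le N$ and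 $0\le n\le N$. Define $$\Psi_{\boldsymbol n}(\boldsymbol y)=\delta_{N_dY_d}\prod_{k=1}^{d-1}\widehat h_{n_k}\bigl(Y_k-N_{k-1},\;2N_{k-1}+A_k+k-1,\;\alpha_{k+1},\;Y_{k+1}-N_{k-1};\,q\bigr).$$ Then for each $\boldsymbol n$ only finitely many $\Psi_{\boldsymbol n}(\boldsymbol y)$ are nonzero, for each $\boldsymbol y$ only finitely many $\Psi_{\boldsymbol n}(\boldsymbol y)$ are nonzero, and $$\sum_{\boldsymbol y}\Psi_{\boldsymbol n}(\boldsymbol y)\Psi_{\boldsymbol n'}(\boldsymbol y)=\delta_{\boldsymbol n\boldsymbol n'},\qquad\sum_{\boldsymbol n}\Psi_{\boldsymbol n}(\boldsymbol y)\Psi_{\boldsymbol n}(\boldsymbol y')=\delta_{\boldsymbol y\boldsymbol y'}.$$ Moreover, there is a coupled basis $(g_{\boldsymbol n})$ with $$g_{\boldsymbol n}=\sum_{\boldsymbol y}\Psi_{\boldsymbol n}(\boldsymbol y)\,e_{\boldsymbol y},\qquad e_{\boldsymbol y}=\sum_{\boldsymbol n}\Psi_{\boldsymbol n}(\boldsymbol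 y)\,g_{\boldsymbol n}\qquad(*)$$ for all $\boldsymbol n,\boldsymbol y$, and every coupled basis satisfies $(*)$ after each vector $g_{\boldsymbol n}$ is multiplied by a suitable scalar of absolute value $1$. -/

import Mathlib

open scoped TensorProduct ComplexConjugate

noncomputable section

namespace SuQ

/-! ### Basic hypergeometric series and `q`-Hahn functions -/

/-- The `q`-Pochhammer symbol `(a;q)_n`. -/
def qPoch (a q : ℝ) (n : ℕ) : ℝ := ∏ i ∈ Finset.range n, (1 - a * q ^ i)

/-- The basic hypergeometric series `_rφ_s` with upper parameters `a`, lower parameters `b`,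
base `q` and argument `z`. -/
def basicHypergeometric (a b : List ℝ) (q z : ℝ) : ℝ :=
  ∑' k : ℕ,
    (a.map fun c => qPoch c q k).prod / (qPoch q q k * (b.map fun c => qPoch c q k).prod)
      * ((-1) ^ k * q ^ k.choose 2) ^ ((1 : ℤ) + (b.length : ℤ) - (a.length : ℤ)) * z ^ k

/-- The `q`-Hahn polynomial `h_n(x, α, β, N; q)`, for `n, x ≤ N`. The series terminates after
the term of index `min n x ≤ N`; the later terms, which have a factor `0` in the numerator, vanish
(also those of index `> N`, by `0 / 0 = 0`). -/
def hahn (q : ℝ) (n x : ℕ) (α β : ℝ) (N : ℕ) : ℝ :=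
  qPoch (q ^ (α + 1)) q n * qPoch (q ^ (-(N : ℝ))) q n *
    basicHypergeometric [q ^ (-(n : ℝ)), q ^ (n + α + β + 1), q ^ (-(x : ℝ))]
      [q ^ (α + 1), q ^ (-(N : ℝ))] q q

/-- The weight `ω(x; α, β, N; q)`, for `x ≤ N`. -/
def hahnWeight (q : ℝ) (x : ℕ) (α β : ℝ) (N : ℕ) : ℝ :=
  qPoch (q ^ (α + 1)) q x * qPoch (q ^ (β + 1)) q (N - x) / (qPoch q q x * qPoch q q (N - x))
    * q ^ (((N : ℝ) - x) * (α + 1))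

/-- The normalization `η(n, α, β, N; q)`, for `n ≤ N`. -/
def hahnNorm (q : ℝ) (n : ℕ) (α β : ℝ) (N : ℕ) : ℝ :=
  qPoch (q ^ (α + β + 2)) q (n + N) / qPoch q q (N - n)
    * q ^ (2 * (n.choose 2 : ℝ) - 2 * (N : ℝ) * n)
    * ((1 - q ^ (α + β + 1)) / (1 - q ^ (2 * (n : ℝ) + α + β + 1)))
    * (qPoch q q n * qPoch (q ^ (α + 1)) q n * qPoch (q ^ (β + 1)) q n
        / qPoch (q ^ (α + β + 1)) q n)
    * q ^ ((n : ℝ) * (α + 1))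

/-- The orthonormal `q`-Hahn function `ĥ_n(x, α, β, N; q)`. It lives on `0 ≤ x ≤ N` and
`0 ≤ n ≤ N`, and is `0` outside that range, as a Clebsch–Gordan coefficient is. -/
def hahnFun (q : ℝ) (n : ℕ) (x : ℤ) (α β : ℝ) (N : ℤ) : ℝ :=
  if 0 ≤ x ∧ x ≤ N ∧ (n : ℤ) ≤ N then
    √(hahnWeight q x.toNat α β N.toNat / hahnNorm q n α β N.toNat)
      * hahn q n x.toNat α β N.toNat
  else 0

/-- The partial sum `v_1 + ⋯ + v_k` of a tuple `(v_1, …, v_d)`. -/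
def psum {d : ℕ} {M : Type*} [AddCommMonoid M] (v : Fin d → M) (k : ℕ) : M :=
  ∑ i with i.val < k, v i

/-- The functions `Ψ_n(y)`. The factor with (zero-based) index `j` is the factor `k = j + 1` of
the product over `1 ≤ k ≤ d - 1`. -/
def Psi {d : ℕ} (q : ℝ) (α : Fin d → ℝ) (n y : Fin d → ℕ) : ℝ :=
  (if psum n d = psum y d then 1 else 0) *
    ∏ j : Fin (d - 1),
      hahnFun q (n ⟨j, by omega⟩)
        (((psum y (j + 1) : ℕ) : ℤ) - ((psum n j : ℕ) : ℤ))
        (2 * ((psum n j : ℕ) : ℝ) + psum α (j + 1) + j)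
        (α ⟨j + 1, by omega⟩)
        (((psum y (j + 2) : ℕ) : ℤ) - ((psum n j : ℕ) : ℤ))

/-! ### The positive-discrete series -/

/-- The squared matrix elements `σ_n^{(α)}`. -/
def sigma (q α : ℝ) (n : ℕ) : ℝ :=
  q ^ (1 / 2 : ℝ) * ((1 - q ^ n) * (1 - q ^ ((n : ℝ) + α)) / (1 - q) ^ 2)

/-- The eigenvalue `n + (α + 1) / 2` of `A_0` on `e_n^{(α)}`. -/
def weight (α : ℝ) (n : ℕ) : ℝ := n + (α + 1) / 2

/-- The Casimir eigenvalue `γ(α)`. -/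
def gam (q α : ℝ) : ℝ :=
  (q ^ (α / 2) + q ^ (-α / 2)) / (q ^ (1 / 2 : ℝ) - q ^ (-1 / 2 : ℝ)) ^ 2

variable (𝕜 : Type*) [RCLike 𝕜]

/-- The underlying space of every `V^{(α)}`, with basis `e_n = Finsupp.single n 1`. -/
abbrev V : Type _ := ℕ →₀ 𝕜

/-- The operator `q^{c A_0}` on `V^{(α)}`. -/
def qA0 (q α c : ℝ) : Module.End 𝕜 (V 𝕜) :=
  Finsupp.linearCombination 𝕜 fun n =>
    ((q ^ (c * weight α n) : ℝ) : 𝕜) • (Finsupp.single n 1 : V 𝕜)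

/-- The operator `A_+` on `V^{(α)}`. -/
def Aplus (q α : ℝ) : Module.End 𝕜 (V 𝕜) :=
  Finsupp.linearCombination 𝕜 fun n =>
    ((√(sigma q α (n + 1)) : ℝ) : 𝕜) • (Finsupp.single (n + 1) 1 : V 𝕜)

/-- The operator `A_-` on `V^{(α)}`; it kills `e_0`, as `σ_0 = 0`. -/
def Aminus (q α : ℝ) : Module.End 𝕜 (V 𝕜) :=
  Finsupp.linearCombination 𝕜 fun n =>
    ((√(sigma q α n) : ℝ) : 𝕜) • (Finsupp.single (n - 1) 1 : V 𝕜)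

/-! ### The `d`-fold tensor product -/

/-- The underlying space of `W^{(α)} = V^{(α_1)} ⊗ ⋯ ⊗ V^{(α_d)}`. -/
abbrev W (d : ℕ) : Type _ := ⨂[𝕜] _ : Fin d, V 𝕜

/-- The direct product basis `e_y = e_{y_1} ⊗ ⋯ ⊗ e_{y_d}`. -/
def prodBasis (d : ℕ) : Module.Basis (Fin d → ℕ) 𝕜 (W 𝕜 d) :=
  Basis.piTensorProduct fun _ => Finsupp.basisSingleOne

theorem prodBasis_apply (d : ℕ) (y : Fin d → ℕ) :
    prodBasis 𝕜 d y = ⨂ₜ[𝕜] i, (Finsupp.single (y i) 1 : V 𝕜) := by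
  simp [prodBasis]

variable {𝕜}

/-- The inner product of `W^{(α)}`, for which the direct product basis is orthonormal. -/
def innerW {d : ℕ} (u v : W 𝕜 d) : 𝕜 :=
  ((prodBasis 𝕜 d).repr u).sum fun y c => conj c * (prodBasis 𝕜 d).repr v y

variable (𝕜)

/-- The operator `T^{(k)}`: `T` acting on the `k`-th tensor factor. -/
def site {d : ℕ} (k : Fin d) (T : Module.End 𝕜 (V 𝕜)) : Module.End 𝕜 (W 𝕜 d) :=
  PiTensorProduct.map (Function.update (fun _ => LinearMap.id) k T)

variable {d : ℕ} (q : ℝ) (α : Fin d → ℝ)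

/-- The operator `q^{c A_0^S}` on `W^{(α)}`, where `A_0^S = ∑_{k ∈ S} A_0^{(k)}`. -/
def qA0On (S : Finset (Fin d)) (c : ℝ) : Module.End 𝕜 (W 𝕜 d) :=
  PiTensorProduct.map fun k => if k ∈ S then qA0 𝕜 q (α k) c else LinearMap.id

/-- `A_+^S = ∑_{k ∈ S} q^{∑_{ℓ ∈ S, ℓ < k} A_0^{(ℓ)}} A_+^{(k)}`. -/
def AplusOn (S : Finset (Fin d)) : Module.End 𝕜 (W 𝕜 d) :=
  ∑ k ∈ S, qA0On 𝕜 q α {l ∈ S | l < k} 1 * site 𝕜 k (Aplus 𝕜 q (α k))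

/-- `A_-^S = ∑_{k ∈ S} q^{∑_{ℓ ∈ S, ℓ < k} A_0^{(ℓ)}} A_-^{(k)}`. -/
def AminusOn (S : Finset (Fin d)) : Module.End 𝕜 (W 𝕜 d) :=
  ∑ k ∈ S, qA0On 𝕜 q α {l ∈ S | l < k} 1 * site 𝕜 k (Aminus 𝕜 q (α k))

/-- The intermediate Casimir operator
`Γ^S = (q^{-1/2} q^{A_0^S} + q^{1/2} q^{-A_0^S}) / (q^{1/2} - q^{-1/2})² - A_+^S A_-^S q^{1 - A_0^S}`.
-/
def casimir (S : Finset (Fin d)) : Module.End 𝕜 (W 𝕜 d) :=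
  ((((q ^ (1 / 2 : ℝ) - q ^ (-1 / 2 : ℝ)) ^ 2)⁻¹ : ℝ) : 𝕜) •
      (((q ^ (-1 / 2 : ℝ) : ℝ) : 𝕜) • qA0On 𝕜 q α S 1
        + ((q ^ (1 / 2 : ℝ) : ℝ) : 𝕜) • qA0On 𝕜 q α S (-1))
    + (-1 : 𝕜) • (AplusOn 𝕜 q α S * AminusOn 𝕜 q α S * ((q : 𝕜) • qA0On 𝕜 q α S (-1)))

/-- The set `[1;k]`, as a set of (zero-based) indices in `Fin d`. -/
def initialSet (d k : ℕ) : Finset (Fin d) := {i | i.val < k}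

variable {𝕜}

/-- `g` is an orthonormal basis of `W^{(α)}` whose vectors `g_n` are joint eigenvectors of
`Γ^{[1;2]}, …, Γ^{[1;d]}` and `q^{A_0^{[1;d]}}`, with the eigenvalues
`γ(2 N_{k-1} + A_k + k - 1)`, `2 ≤ k ≤ d`, and `q^{N_d + (A_d + d)/2}`. -/
structure IsCoupledBasis (g : (Fin d → ℕ) → W 𝕜 d) : Prop where
  orthonormal : ∀ n n', innerW (g n) (g n') = if n = n' then 1 else 0
  span_eq_top : Submodule.span 𝕜 (Set.range g) = ⊤
  casimir_eigen : ∀ n, ∀ k ∈ Finset.Icc 2 d,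
    casimir 𝕜 q α (initialSet d k) (g n)
      = ((gam q (2 * ((psum n (k - 1) : ℕ) : ℝ) + psum α k + k - 1) : ℝ) : 𝕜) • g n
  qA0_eigen : ∀ n,
    qA0On 𝕜 q α (initialSet d d) 1 (g n)
      = ((q ^ (((psum n d : ℕ) : ℝ) + (psum α d + d) / 2) : ℝ) : 𝕜) • g n

/-- The two expansion formulas `g_n = ∑_y Ψ_n(y) e_y` and `e_y = ∑_n Ψ_n(y) g_n`
(sums with finitely many nonzero coefficients). -/
def HasPsiExpansions (g : (Fin d → ℕ) → W 𝕜 d) : Prop :=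
  (∀ n, g n = ∑ᶠ y, (Psi q α n y : 𝕜) • prodBasis 𝕜 d y) ∧
    ∀ y, prodBasis 𝕜 d y = ∑ᶠ n, (Psi q α n y : 𝕜) • g n

end SuQ

end

namespace SuQ

/-! The coefficients `Psi` are iterated Clebsch–Gordan coefficients. A block of the first `j + 1`
tensor factors, coupled into a constituent of parameter `coupledParam α n j`, is tensored with the
next factor. This is a product of two positive-discrete series, and its coupling coefficients are
the `hahnFun`.

Everything rests on two relations, `hahnFun_raising` and `hahnFun_lowering`. They say that on
`V^{(a)} ⊗ V^{(b)}` the operators `A_±` act on the vectors with `q`-Hahn coefficients of degree `n`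
as they do in `V^{(2n+a+b+1)}`, degree `N` being level `N - n`. They are contiguous relations of the
polynomials `hahnPoly`, dressed with square roots of weights and norms. Since `A_+` and `A_-` are
adjoint, they also give orthonormality of the `q`-Hahn functions (`sum_hahnFun_mul`) by induction on
`N`. The new vector in degree `N` is the one with `n = N`; it is killed by `A_-`, so its
coefficients are explicit and the `q`-Chu–Vandermonde sum normalizes it.

Applied one tensor factor after another, the relations describe `A_±^{[1;k]}` on the partial
products `partialPsi`. The other factors of `Psi` depend only on the sums `Y_m` with `m ≥ k`, which
`A_+A_-` on the first `k` factors preserves. Hence `Γ^{[1;k]}` acts by its value on an irreducible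
module (`casimirFun_Psi`). Row orthonormality of `Psi` follows by summing out the last factor
repeatedly; column orthonormality follows because `Psi` is a finite square matrix in each degree.

For uniqueness, the joint eigenvalues determine all `N_k`, hence the index (`eq_of_eigenvalues_eq`).
So the joint eigenspaces are lines, and a unit vector in a line is fixed up to a phase. -/

/-! ### `q`-Pochhammer symbols. -/

theorem qPoch_zero (a q : ℝ) : qPoch a q 0 = 1 := by simp [qPoch]

theorem qPoch_succ (a q : ℝ) (n : ℕ) : qPoch a q (n + 1) = qPoch a q n * (1 - a * q ^ n) := by
  simp [qPoch, Finset.prod_range_succ]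

theorem qPoch_succ' (a q : ℝ) (n : ℕ) : qPoch a q (n + 1) = (1 - a) * qPoch (a * q) q n := by
  simp only [qPoch, Finset.prod_range_succ']
  rw [mul_comm]
  congr 1
  · simp
  · refine Finset.prod_congr rfl fun i _ => ?_
    ring

theorem qPoch_add (a q : ℝ) (m n : ℕ) :
    qPoch a q (m + n) = qPoch a q m * qPoch (a * q ^ m) q n := by
  induction n with
  | zero => simp [qPoch_zero]
  | succ n ih => rw [← add_assoc, qPoch_succ, qPoch_succ, ih, pow_add]; ring

theorem qPoch_pos {a q : ℝ} (hq0 : 0 < q) (hq1 : q < 1) (ha : a < 1) (n : ℕ) :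
    0 < qPoch a q n := by
  refine Finset.prod_pos fun i _ => ?_
  have h1 : 0 < q ^ i := pow_pos hq0 i
  have h2 : q ^ i ≤ 1 := pow_le_one₀ hq0.le hq1.le
  nlinarith

theorem qPoch_inv_pow_eq_zero {q : ℝ} (hq0 : 0 < q) {n k : ℕ} (h : n < k) :
    qPoch (q ^ n)⁻¹ q k = 0 := by
  refine Finset.prod_eq_zero (Finset.mem_range.2 h) ?_
  rw [inv_mul_cancel₀ (pow_pos hq0 n).ne', sub_self]

theorem qPoch_inv_pow_ne_zero {q : ℝ} (hq0 : 0 < q) (hq1 : q < 1) {n k : ℕ} (h : k ≤ n) :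
    qPoch (q ^ n)⁻¹ q k ≠ 0 := by
  refine Finset.prod_ne_zero_iff.2 fun i hi => ?_
  have hi : i < n := (Finset.mem_range.1 hi).trans_le h
  have := pow_lt_pow_right_of_lt_one₀ hq0 hq1 hi
  have hn := pow_pos hq0 n
  rw [sub_ne_zero, ne_comm, inv_mul_eq_div, ne_eq, div_eq_one_iff_eq hn.ne']
  exact this.ne'

/-! ### Contiguous relations of the `q`-Hahn polynomials. -/

/-- The coefficients of `hahnPoly`. -/
noncomputable def hahnCoeff (q A B : ℝ) (n k : ℕ) : ℝ :=
  qPoch (q ^ n)⁻¹ q k * qPoch (A * B * q ^ n / q) q k / qPoch q q k * q ^ k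
    * qPoch (A * q ^ k) q (n - k)

/-- The `q`-Hahn polynomial with `A = q ^ (α + 1)`, `B = q ^ (β + 1)`, `X = q ^ (-x)` and
`Z = q ^ (-N)`, written without denominators in `A` and `Z`. -/
noncomputable def hahnPoly (q A B : ℝ) (n : ℕ) (X Z : ℝ) : ℝ :=
  ∑ k ∈ Finset.range (n + 1), hahnCoeff q A B n k * (qPoch X q k * qPoch (q ^ k * Z) q (n - k))

/-- The identity holds term by term in `k`, so the coefficients `hahnCoeff` play no role: both sides
of the `k`-th term contain `(X;q)_k (q^{k+1}Z;q)_{n-k}` up to a linear factor. -/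
theorem hahnPoly_raising (q A B : ℝ) (n : ℕ) (X Z : ℝ) :
    (X - 1) * Z * hahnPoly q A B n (q * X) (q * Z) + (Z - X) * hahnPoly q A B n X (q * Z)
      = X * (q ^ n * Z - 1) * hahnPoly q A B n X Z := by
  simp only [hahnPoly, Finset.mul_sum, ← Finset.sum_add_distrib]
  refine Finset.sum_congr rfl fun k hk => ?_
  obtain ⟨r, rfl⟩ := Nat.exists_eq_add_of_le (Nat.lt_succ_iff.1 (Finset.mem_range.1 hk))
  rw [Nat.add_sub_cancel_left]
  have h1 : (X - 1) * qPoch (q * X) q k = -(qPoch X q k * (1 - X * q ^ k)) := by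
    rw [← qPoch_succ, qPoch_succ', mul_comm q]; ring
  have h2 : (1 - q ^ k * Z) * qPoch (q ^ k * (q * Z)) q r
      = qPoch (q ^ k * Z) q r * (1 - q ^ k * Z * q ^ r) := by
    rw [← qPoch_succ, qPoch_succ']; congr 2; ring
  rw [pow_add]
  linear_combination hahnCoeff q A B (k + r) k * Z * qPoch (q ^ k * (q * Z)) q r * h1
    - hahnCoeff q A B (k + r) k * X * qPoch X q k * h2

/-- The ratio of consecutive coefficients, cross-multiplied because `1 - A q^k` may vanish. It
drives the telescoping in `hahnPoly_lowering`. -/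
theorem hahnCoeff_succ {q : ℝ} (hq0 : 0 < q) (hq1 : q < 1) (A B : ℝ) (k r : ℕ) :
    hahnCoeff q A B (k + 1 + r) (k + 1) * (1 - A * q ^ k) * (1 - q ^ (k + 1))
      = hahnCoeff q A B (k + 1 + r) k * (1 - (q ^ (r + 1))⁻¹) *
        (1 - A * B * q ^ (2 * k + r)) * q := by
  have e1 : k + 1 + r - k = r + 1 := by omega
  have e2 : k + 1 + r - (k + 1) = r := by omega
  have hq : q ≠ 0 := hq0.ne'
  have hk := (qPoch_pos hq0 hq1 hq1 k).ne'
  have hk1 : (1 - q * q ^ k) ≠ 0 := by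
    have := pow_lt_one₀ hq0.le hq1 (Nat.succ_ne_zero k)
    rw [pow_succ] at this; nlinarith
  simp only [hahnCoeff, e1, e2]
  rw [qPoch_succ' (A * q ^ k), qPoch_succ, qPoch_succ, qPoch_succ,
    show A * q ^ (k + 1) = A * q ^ k * q by ring]
  generalize qPoch (q ^ (k + 1 + r))⁻¹ q k = u
  generalize qPoch (A * B * q ^ (k + 1 + r) / q) q k = v
  generalize qPoch q q k = w at *
  generalize qPoch (A * q ^ k * q) q r = z
  rw [show (1 - q ^ (k + 1)) = 1 - q * q ^ k by ring]
  generalize 1 - q * q ^ k = d at *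
  field_simp
  ring

/-- Unlike the raising relation, this one fails term by term. The differences `D k` of the two sides
telescope, and the closed form of their partial sums vanishes at the last index. -/
theorem hahnPoly_lowering {q : ℝ} (hq0 : 0 < q) (hq1 : q < 1) (A B : ℝ) (n : ℕ) (X Z : ℝ) :
    Z * (q * X - A) * hahnPoly q A B n X Z + A * (Z - B * X) * hahnPoly q A B n (q * X) Z
      = (q ^ n)⁻¹ * X * (q * Z - A * B * q ^ n) * hahnPoly q A B n (q * X) (q * Z) := by
  have hq : q ≠ 0 := hq0.ne'
  let D : ℕ → ℝ := fun k => hahnCoeff q A B n k *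
    (Z * (q * X - A) * (qPoch X q k * qPoch (q ^ k * Z) q (n - k))
      + A * (Z - B * X) * (qPoch (q * X) q k * qPoch (q ^ k * Z) q (n - k))
      - (q ^ n)⁻¹ * X * (q * Z - A * B * q ^ n) *
        (qPoch (q * X) q k * qPoch (q ^ k * (q * Z)) q (n - k)))
  -- Here `r = n - m` counts the remaining terms. The truncated `r - 1` is harmless at `r = 0`,
  -- where the factor `1 - (q ^ r)⁻¹` is zero; that factor also ends the telescoping.
  have key : ∀ m r, n = m + r → ∑ k ∈ Finset.range (m + 1), D k =
      X * Z * hahnCoeff q A B n m * qPoch (q ^ (m + 1) * Z) q (r - 1) * (1 - (q ^ r)⁻¹) *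
        (q - A * B * q ^ (n + m)) * (q ^ m)⁻¹ * qPoch (q * X) q m := by
    intro m
    induction m with
    | zero =>
      intro r hr
      obtain rfl : n = r := by omega
      simp only [zero_add, Finset.sum_range_one, D, qPoch_zero, Nat.sub_zero, pow_zero, one_mul]
      rcases n with _ | s
      · simp only [qPoch_zero, pow_zero]; ring
      · rw [qPoch_succ' Z, qPoch_succ (q * Z)]
        simp only [Nat.add_sub_cancel, pow_one, mul_comm Z q]
        field_simp
        ring
    | succ k ih =>
      intro r hr
      rw [Finset.sum_range_succ, ih (r + 1) (by omega)]
      subst hr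
      have hk1 : (1 - q ^ (k + 1)) ≠ 0 := by
        have := pow_lt_one₀ hq0.le hq1 (Nat.succ_ne_zero k)
        exact (sub_pos.2 this).ne'
      have hc := hahnCoeff_succ hq0 hq1 A B k r
      have hX : qPoch X q (k + 1) = (1 - X) * qPoch (q * X) q k := by
        rw [qPoch_succ', mul_comm X q]
      simp only [D]
      rw [hX, qPoch_succ (q * X)]
      have e2 : k + 1 + r - (k + 1) = r := by omega
      rw [e2, Nat.add_sub_cancel]
      generalize hahnCoeff q A B (k + 1 + r) (k + 1) = c1 at *
      generalize hahnCoeff q A B (k + 1 + r) k = c0 at *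
      generalize qPoch (q * X) q k = x at *
      have hc' : c0 * (1 - (q ^ (r + 1))⁻¹) * (q - A * B * q ^ (k + 1 + r + k)) =
          c1 * (1 - A * q ^ k) * (1 - q ^ (k + 1)) := by
        rw [hc, show k + 1 + r + k = 2 * k + r + 1 by omega, pow_succ q (2 * k + r)]; ring
      have hstep : X * Z * c0 * qPoch (q ^ (k + 1) * Z) q r * (1 - (q ^ (r + 1))⁻¹) *
          (q - A * B * q ^ (k + 1 + r + k)) * (q ^ k)⁻¹ * x
          = X * Z * qPoch (q ^ (k + 1) * Z) q r * (q ^ k)⁻¹ * x *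
            (c1 * (1 - A * q ^ k) * (1 - q ^ (k + 1))) := by
        rw [← hc']; ring
      rw [hstep]
      rcases r with _ | s
      · simp only [qPoch_zero, add_zero, pow_zero, inv_one, sub_self, mul_zero, zero_mul]
        field_simp
        ring
      · rw [qPoch_succ' (q ^ (k + 1) * Z), show q ^ (k + 1) * (q * Z) = q ^ (k + 1) * Z * q by ring,
          qPoch_succ (q ^ (k + 1) * Z * q), Nat.add_sub_cancel,
          show q ^ (k + 1 + 1) * Z = q ^ (k + 1) * Z * q by ring]
        generalize qPoch (q ^ (k + 1) * Z * q) q s = z at *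
        field_simp
        ring
  have h := key n 0 rfl
  rw [pow_zero, inv_one, sub_self, mul_zero, zero_mul, zero_mul, zero_mul] at h
  rw [← sub_eq_zero, ← h]
  simp only [hahnPoly, Finset.mul_sum, ← Finset.sum_add_distrib, ← Finset.sum_sub_distrib, D]
  exact Finset.sum_congr rfl fun k _ => by ring

/-- In degree `N + 1` every summand vanishes at the lattice points: for `k > x` through
`(q^{-x};q)_k`, for `k ≤ x` through the factor `1 - q^0` of `(q^{k-N};q)_{N+1-k}`. This matches the
convention that `hahnFun` is zero for `n > N`. -/
theorem hahnPoly_eq_zero {q : ℝ} (hq0 : 0 < q) (A B : ℝ) {x N : ℕ} (hx : x ≤ N) :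
    hahnPoly q A B (N + 1) (q ^ x)⁻¹ (q ^ N)⁻¹ = 0 := by
  refine Finset.sum_eq_zero fun k hk => ?_
  have hk := Finset.mem_range.1 hk
  rcases Nat.lt_or_ge x k with h | h
  · simp [qPoch_inv_pow_eq_zero hq0 h]
  · have h0 : qPoch (q ^ k * (q ^ N)⁻¹) q (N + 1 - k) = 0 := by
      refine Finset.prod_eq_zero (i := N - k) (Finset.mem_range.2 (by omega)) ?_
      have : q ^ k * (q ^ N)⁻¹ * q ^ (N - k) = 1 := by
        rw [mul_right_comm, ← pow_add, show k + (N - k) = N by omega,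
          mul_inv_cancel₀ (pow_pos hq0 N).ne']
      rw [this, sub_self]
    rw [h0, mul_zero, mul_zero]

theorem rpow_neg_natCast_eq {q : ℝ} (hq0 : 0 < q) (n : ℕ) : q ^ (-(n : ℝ)) = (q ^ n)⁻¹ := by
  rw [Real.rpow_neg hq0.le, Real.rpow_natCast]

/-- The prefactors of `hahn` cancel the denominators of the series, leaving `(A q^k;q)_{n-k}` and
`(q^{k-N};q)_{n-k}`. The cancellation needs `k ≤ n ≤ N`, so that `(q^{-N};q)_k` is nonzero. -/
theorem hahn_eq_hahnPoly {q : ℝ} (hq0 : 0 < q) (hq1 : q < 1) {n x N : ℕ} {a : ℝ} (b : ℝ)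
    (ha : 0 < a) (hn : n ≤ N) :
    hahn q n x a b N = hahnPoly q (q ^ (a + 1)) (q ^ (b + 1)) n (q ^ x)⁻¹ (q ^ N)⁻¹ := by
  have hA : q ^ (a + 1) < 1 := Real.rpow_lt_one hq0.le hq1 (by linarith)
  have e : q ^ ((n : ℝ) + a + b + 1) = q ^ (a + 1) * q ^ (b + 1) * q ^ n / q := by
    rw [← Real.rpow_natCast, ← Real.rpow_add hq0, ← Real.rpow_add hq0]
    nth_rw 3 [← Real.rpow_one q]
    rw [← Real.rpow_sub hq0]; congr 1; ring
  simp only [hahn, basicHypergeometric, rpow_neg_natCast_eq hq0, e]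
  rw [tsum_eq_sum (s := Finset.range (n + 1))]
  · rw [hahnPoly, Finset.mul_sum]
    refine Finset.sum_congr rfl fun k hk => ?_
    have hk : k ≤ n := Nat.lt_succ_iff.1 (Finset.mem_range.1 hk)
    obtain ⟨r, rfl⟩ := Nat.exists_eq_add_of_le hk
    have h1 := (qPoch_pos hq0 hq1 hA k).ne'
    have h2 := qPoch_inv_pow_ne_zero hq0 hq1 (hk.trans hn)
    have h3 := (qPoch_pos hq0 hq1 hq1 k).ne'
    rw [qPoch_add _ _ k r, qPoch_add (q ^ N)⁻¹ _ k r, hahnCoeff, Nat.add_sub_cancel_left,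
      mul_comm (q ^ k) (q ^ N)⁻¹]
    simp only [List.map_cons, List.map_nil, List.prod_cons, List.prod_nil, List.length_cons,
      List.length_nil]
    generalize qPoch (q ^ N)⁻¹ q k = z at *
    generalize qPoch q q k = w at *
    norm_num
    field_simp
  · intro k hk
    have hk : n < k := by simpa using hk
    simp [qPoch_inv_pow_eq_zero hq0 hk]

/-! ### Gaussian binomials and the `q`-Chu–Vandermonde sum. -/

/-- The Gaussian binomial coefficient. -/
noncomputable def gaussBinom (q : ℝ) : ℕ → ℕ → ℝ
  | _, 0 => 1
  | 0, _ + 1 => 0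
  | n + 1, k + 1 => gaussBinom q n (k + 1) + q ^ (n - k) * gaussBinom q n k

theorem gaussBinom_zero_right (q : ℝ) (n : ℕ) : gaussBinom q n 0 = 1 := by
  cases n <;> simp [gaussBinom]

theorem gaussBinom_eq_zero (q : ℝ) {n k : ℕ} (h : n < k) : gaussBinom q n k = 0 := by
  induction n generalizing k with
  | zero => obtain ⟨k, rfl⟩ := Nat.exists_eq_succ_of_ne_zero h.ne'; simp [gaussBinom]
  | succ n ih =>
    obtain ⟨k, rfl⟩ := Nat.exists_eq_succ_of_ne_zero (Nat.ne_zero_of_lt h)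
    simp only [Nat.succ_eq_add_one] at *
    simp [gaussBinom, ih (show n < k by omega), ih (show n < k + 1 by omega)]

theorem gaussBinom_mul (q : ℝ) (k r : ℕ) :
    gaussBinom q (k + r) k * (qPoch q q k * qPoch q q r) = qPoch q q (k + r) := by
  induction h : k + r generalizing k r with
  | zero =>
    obtain ⟨rfl, rfl⟩ : k = 0 ∧ r = 0 := by omega
    simp [gaussBinom, qPoch_zero]
  | succ n ih =>
    rcases k with _ | k
    · obtain rfl : r = n + 1 := by omega
      simp [gaussBinom, qPoch_zero]
    · rcases r with _ | r
      · obtain rfl : k = n := by omega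
        have := ih k 0 rfl
        simp only [qPoch_zero, mul_one] at this
        simp only [gaussBinom, gaussBinom_eq_zero q (Nat.lt_succ_self k), qPoch_zero, qPoch_succ,
          Nat.sub_self, pow_zero]
        linear_combination (1 - q * q ^ k) * this
      · have h1 := ih (k + 1) r (by omega)
        have h2 := ih k (r + 1) (by omega)
        obtain rfl : n = k + (r + 1) := by omega
        rw [gaussBinom, Nat.add_sub_cancel_left, qPoch_succ q q (k + (r + 1)), pow_add]
        rw [qPoch_succ q q k] at h1 ⊢
        rw [qPoch_succ q q r] at h2 ⊢
        linear_combination (1 - q * q ^ r) * h1 + q ^ (r + 1) * (1 - q * q ^ k) * h2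

/-- A form of the `q`-Chu–Vandermonde summation. -/
theorem sum_gaussBinom (q A B : ℝ) (n : ℕ) :
    ∑ x ∈ Finset.range (n + 1), gaussBinom q n x * qPoch (A * q ^ x) q (n - x) *
      qPoch (B * q ^ (n - x)) q x * q ^ (x * (x - 1)) * A ^ x
      = ∏ i ∈ Finset.range n, (1 - A * B * q ^ (n - 1 + i)) := by
  induction n generalizing A B with
  | zero => simp [gaussBinom, qPoch_zero]
  | succ n ih =>
    -- The Pascal rule splits the sum into the sums for `(A, Bq)` and `(Aq, B)`, which share the
    -- product on the right. Their prefactors combine by `(1 - A q^n) + A q^n (1 - B q^n) = 1 - A B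
    -- q^{2n}`.
    have hA := ih A (B * q)
    have hB := ih (A * q) B
    have split : ∀ f : ℕ → ℝ, ∑ x ∈ Finset.range (n + 1 + 1), gaussBinom q (n + 1) x * f x =
        ∑ x ∈ Finset.range (n + 1), gaussBinom q n x * f x +
          ∑ x ∈ Finset.range (n + 1), q ^ (n - x) * gaussBinom q n x * f (x + 1) := by
      intro f
      rw [Finset.sum_range_succ', gaussBinom_zero_right]
      simp only [gaussBinom, add_mul, Finset.sum_add_distrib]
      rw [Finset.sum_range_succ, gaussBinom_eq_zero q (Nat.lt_succ_self n),
        Finset.sum_range_succ' (fun x => gaussBinom q n x * f x), gaussBinom_zero_right]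
      ring
    simp only [mul_assoc]
    rw [split]
    have s1 : ∑ x ∈ Finset.range (n + 1), gaussBinom q n x * (qPoch (A * q ^ x) q (n + 1 - x) *
        (qPoch (B * q ^ (n + 1 - x)) q x * (q ^ (x * (x - 1)) * A ^ x)))
        = (1 - A * q ^ n) * ∏ i ∈ Finset.range n, (1 - A * (B * q) * q ^ (n - 1 + i)) := by
      rw [← hA, Finset.mul_sum]
      refine Finset.sum_congr rfl fun x hx => ?_
      obtain ⟨r, rfl⟩ := Nat.exists_eq_add_of_le (Nat.lt_succ_iff.1 (Finset.mem_range.1 hx))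
      rw [show x + r + 1 - x = r + 1 by omega, Nat.add_sub_cancel_left, qPoch_succ,
        show B * q * q ^ r = B * q ^ (r + 1) by ring]
      ring
    have s2 : ∑ x ∈ Finset.range (n + 1), q ^ (n - x) * gaussBinom q n x *
        (qPoch (A * q ^ (x + 1)) q (n + 1 - (x + 1)) *
        (qPoch (B * q ^ (n + 1 - (x + 1))) q (x + 1) *
          (q ^ ((x + 1) * (x + 1 - 1)) * A ^ (x + 1))))
        = A * q ^ n * (1 - B * q ^ n) *
          ∏ i ∈ Finset.range n, (1 - A * q * B * q ^ (n - 1 + i)) := by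
      rw [← hB, Finset.mul_sum]
      refine Finset.sum_congr rfl fun x hx => ?_
      obtain ⟨r, rfl⟩ := Nat.exists_eq_add_of_le (Nat.lt_succ_iff.1 (Finset.mem_range.1 hx))
      rw [show x + r + 1 - (x + 1) = r by omega, Nat.add_sub_cancel_left, qPoch_succ,
        show A * q * q ^ x = A * q ^ (x + 1) by ring, Nat.add_sub_cancel]
      have : q ^ ((x + 1) * x) = q ^ (x * (x - 1)) * q ^ x * q ^ x := by
        rcases x with _ | x
        · simp
        · rw [← pow_add, ← pow_add, Nat.add_sub_cancel]; congr 1; ring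
      rw [this, mul_pow]
      ring
    rw [s1, s2, Finset.prod_range_succ]
    have e1 : ∀ C : ℝ, C = A * B * q → ∏ i ∈ Finset.range n, (1 - C * q ^ (n - 1 + i)) =
        ∏ i ∈ Finset.range n, (1 - A * B * q ^ (n + 1 - 1 + i)) := by
      rintro C rfl
      refine Finset.prod_congr rfl fun i hi => ?_
      have := Finset.mem_range.1 hi
      rw [show n + 1 - 1 + i = n - 1 + i + 1 by omega, pow_succ q (n - 1 + i)]; ring
    rw [e1 (A * (B * q)) (by ring), e1 (A * q * B) (by ring), Nat.add_sub_cancel, pow_add q n n]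
    ring_nf

end SuQ
namespace SuQ

/-! ### Ladder relations of the normalized `q`-Hahn functions. -/

variable {q a b : ℝ}

theorem one_sub_rpow_pos (hq0 : 0 < q) (hq1 : q < 1) {c : ℝ} (hc : 0 < c) : 0 < 1 - q ^ c :=
  sub_pos.2 (Real.rpow_lt_one hq0.le hq1 hc)

theorem one_sub_pow_nonneg (hq0 : 0 < q) (hq1 : q < 1) (n : ℕ) : 0 ≤ 1 - q ^ n :=
  sub_nonneg.2 (pow_le_one₀ hq0.le hq1.le)

theorem one_sub_pow_pos (hq0 : 0 < q) (hq1 : q < 1) {n : ℕ} (hn : n ≠ 0) : 0 < 1 - q ^ n :=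
  sub_pos.2 (pow_lt_one₀ hq0.le hq1 hn)

theorem one_sub_mul_pow_pos (hq0 : 0 < q) (hq1 : q < 1) {A : ℝ} (hA : A < 1) (n : ℕ) :
    0 < 1 - A * q ^ n := by
  have h1 : 0 < q ^ n := pow_pos hq0 n
  have h2 : q ^ n ≤ 1 := pow_le_one₀ hq0.le hq1.le
  nlinarith

theorem sigma_zero (q a : ℝ) : sigma q a 0 = 0 := by simp [sigma]

theorem sigma_pos (hq0 : 0 < q) (hq1 : q < 1) (ha : 0 < a) {n : ℕ} (hn : n ≠ 0) :
    0 < sigma q a n := by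
  have h1 := one_sub_pow_pos hq0 hq1 hn
  have h2 : 0 < 1 - q ^ ((n : ℝ) + a) := one_sub_rpow_pos hq0 hq1 (by positivity)
  have h3 : 0 < 1 - q := sub_pos.2 hq1
  unfold sigma
  positivity

theorem sigma_nonneg (hq0 : 0 < q) (hq1 : q < 1) (ha : 0 < a) (n : ℕ) : 0 ≤ sigma q a n := by
  rcases eq_or_ne n 0 with rfl | h
  · rw [sigma_zero]
  · exact (sigma_pos hq0 hq1 ha h).le

/-- The common scalar factor of the matrix elements. -/
noncomputable def ladderScale (q : ℝ) : ℝ := √(q ^ (1 / 2 : ℝ)) / (1 - q)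

theorem ladderScale_nonneg (hq1 : q < 1) : 0 ≤ ladderScale q :=
  div_nonneg (Real.sqrt_nonneg _) (sub_nonneg.2 hq1.le)

theorem sigma_eq (hq0 : 0 < q) (a : ℝ) (n : ℕ) :
    sigma q a n = ladderScale q ^ 2 * ((1 - q ^ n) * (1 - q ^ a * q ^ n)) := by
  rw [sigma, ladderScale, div_pow, Real.sq_sqrt (Real.rpow_nonneg hq0.le _), Real.rpow_add hq0,
    Real.rpow_natCast]
  ring

theorem sigma_succ (hq0 : 0 < q) (a : ℝ) (n : ℕ) : sigma q a (n + 1) =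
    ladderScale q ^ 2 * ((1 - q ^ (n + 1)) * (1 - q ^ (a + 1) * q ^ n)) := by
  rw [sigma_eq hq0, Real.rpow_add hq0, Real.rpow_one, pow_succ]
  ring

theorem hahnWeight_pos (hq0 : 0 < q) (hq1 : q < 1) (ha : 0 < a) (hb : 0 < b) (x N : ℕ) :
    0 < hahnWeight q x a b N := by
  have h1 := qPoch_pos hq0 hq1 (Real.rpow_lt_one hq0.le hq1 (show 0 < a + 1 by linarith))
  have h2 := qPoch_pos hq0 hq1 (Real.rpow_lt_one hq0.le hq1 (show 0 < b + 1 by linarith))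
  have h3 := qPoch_pos hq0 hq1 hq1
  have := h1 x; have := h2 (N - x); have := h3 x; have := h3 (N - x)
  unfold hahnWeight
  positivity

theorem hahnNorm_pos (hq0 : 0 < q) (hq1 : q < 1) (ha : 0 < a) (hb : 0 < b) (n N : ℕ) :
    0 < hahnNorm q n a b N := by
  have h1 := qPoch_pos hq0 hq1 (Real.rpow_lt_one hq0.le hq1 (show 0 < a + 1 by linarith)) n
  have h2 := qPoch_pos hq0 hq1 (Real.rpow_lt_one hq0.le hq1 (show 0 < b + 1 by linarith)) n
  have h3 := qPoch_pos hq0 hq1 hq1 n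
  have h4 := qPoch_pos hq0 hq1 hq1 (N - n)
  have h5 := qPoch_pos hq0 hq1
    (Real.rpow_lt_one hq0.le hq1 (show 0 < a + b + 1 by linarith)) n
  have h6 := qPoch_pos hq0 hq1
    (Real.rpow_lt_one hq0.le hq1 (show 0 < a + b + 2 by linarith)) (n + N)
  have h7 := one_sub_rpow_pos hq0 hq1 (show 0 < a + b + 1 by linarith)
  have h8 := one_sub_rpow_pos hq0 hq1 (show 0 < 2 * (n : ℝ) + a + b + 1 by positivity)
  unfold hahnNorm
  positivity

theorem hahnWeight_eq (hq0 : 0 < q) (a b : ℝ) (x r : ℕ) : hahnWeight q x a b (x + r) =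
    qPoch (q ^ (a + 1)) q x * qPoch (q ^ (b + 1)) q r / (qPoch q q x * qPoch q q r)
      * (q ^ (a + 1)) ^ r := by
  rw [hahnWeight, Nat.add_sub_cancel_left, ← Real.rpow_natCast (q ^ (a + 1)),
    ← Real.rpow_mul hq0.le]
  congr 2
  push_cast
  ring

theorem hahnWeight_succ_succ (hq0 : 0 < q) (hq1 : q < 1) (a b : ℝ) {x N : ℕ} (hx : x ≤ N) :
    hahnWeight q (x + 1) a b (N + 1) * (1 - q ^ (x + 1))
      = hahnWeight q x a b N * (1 - q ^ (a + 1) * q ^ x) := by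
  obtain ⟨r, rfl⟩ := Nat.exists_eq_add_of_le hx
  have h1 := (qPoch_pos hq0 hq1 hq1 x).ne'
  have h2 := (qPoch_pos hq0 hq1 hq1 r).ne'
  have h3 := (one_sub_pow_pos hq0 hq1 (Nat.succ_ne_zero x)).ne'
  rw [show x + r + 1 = x + 1 + r by omega, hahnWeight_eq hq0, hahnWeight_eq hq0, qPoch_succ,
    qPoch_succ, show 1 - q * q ^ x = 1 - q ^ (x + 1) by ring]
  generalize 1 - q ^ (x + 1) = d at *
  field_simp

theorem hahnWeight_succ (hq0 : 0 < q) (hq1 : q < 1) (a b : ℝ) {x N : ℕ} (hx : x ≤ N) :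
    hahnWeight q x a b (N + 1) * (1 - q ^ (N + 1 - x))
      = hahnWeight q x a b N * ((1 - q ^ (b + 1) * q ^ (N - x)) * q ^ (a + 1)) := by
  obtain ⟨r, rfl⟩ := Nat.exists_eq_add_of_le hx
  have h1 := (qPoch_pos hq0 hq1 hq1 x).ne'
  have h2 := (qPoch_pos hq0 hq1 hq1 r).ne'
  have h3 := (one_sub_pow_pos hq0 hq1 (Nat.succ_ne_zero r)).ne'
  rw [show x + r + 1 = x + (r + 1) by omega, hahnWeight_eq hq0, hahnWeight_eq hq0, qPoch_succ,
    qPoch_succ, Nat.add_sub_cancel_left, Nat.add_sub_cancel_left,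
    show 1 - q * q ^ r = 1 - q ^ (r + 1) by ring]
  generalize 1 - q ^ (r + 1) = d at *
  field_simp
  ring

theorem hahnNorm_eq (hq0 : 0 < q) (a b : ℝ) (n r : ℕ) : hahnNorm q n a b (n + r) =
    qPoch (q ^ (a + 1) * q ^ (b + 1)) q (n + (n + r)) / qPoch q q r
    * (q ^ (n * (n + 1)) * q ^ (2 * n * r))⁻¹
    * ((1 - q ^ (a + b + 1)) / (1 - q ^ (2 * (n : ℝ) + a + b + 1)))
    * (qPoch q q n * qPoch (q ^ (a + 1)) q n * qPoch (q ^ (b + 1)) q n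
        / qPoch (q ^ (a + b + 1)) q n)
    * (q ^ (a + 1)) ^ n := by
  have e : (2 * (n.choose 2 : ℝ) - 2 * ((n + r : ℕ) : ℝ) * n) =
      -((n * (n + 1) + 2 * n * r : ℕ) : ℝ) := by
    rw [Nat.cast_choose_two]; push_cast; ring
  rw [hahnNorm, e, rpow_neg_natCast_eq hq0, pow_add, Nat.add_sub_cancel_left, ← Real.rpow_add hq0,
    ← Real.rpow_natCast (q ^ (a + 1)), ← Real.rpow_mul hq0.le, mul_comm (n : ℝ),
    show a + 1 + (b + 1) = a + b + 2 by ring]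

theorem hahnNorm_succ (hq0 : 0 < q) (hq1 : q < 1) (a b : ℝ) {n N : ℕ} (hn : n ≤ N) :
    hahnNorm q n a b (N + 1) * ((1 - q ^ (N + 1 - n)) * q ^ (2 * n))
      = hahnNorm q n a b N * (1 - q ^ (a + 1) * q ^ (b + 1) * q ^ (N + n)) := by
  obtain ⟨r, rfl⟩ := Nat.exists_eq_add_of_le hn
  have h2 := (qPoch_pos hq0 hq1 hq1 r).ne'
  have h3 := (one_sub_pow_pos hq0 hq1 (Nat.succ_ne_zero r)).ne'
  have h4 := (pow_pos hq0 (2 * n)).ne'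
  have h5 := (pow_pos hq0 (2 * n * r)).ne'
  rw [show n + r + 1 = n + (r + 1) by omega, hahnNorm_eq hq0, hahnNorm_eq hq0,
    Nat.add_sub_cancel_left, show n + (n + (r + 1)) = n + (n + r) + 1 by omega, qPoch_succ,
    qPoch_succ, show n + r + n = n + (n + r) by omega, mul_add_one (2 * n) r, pow_add q (2 * n * r),
    show 1 - q * q ^ r = 1 - q ^ (r + 1) by ring]
  generalize 1 - q ^ (r + 1) = d at *
  generalize q ^ (2 * n) = e at *
  generalize q ^ (2 * n * r) = f at *
  generalize (1 - q ^ (a + b + 1)) / (1 - q ^ (2 * (n : ℝ) + a + b + 1)) = g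
  generalize qPoch q q n * qPoch (q ^ (a + 1)) q n * qPoch (q ^ (b + 1)) q n
        / qPoch (q ^ (a + b + 1)) q n = k
  field_simp

theorem hahnFun_natCast (hq0 : 0 < q) (hq1 : q < 1) (ha : 0 < a) {n x N : ℕ} (hx : x ≤ N)
    (hn : n ≤ N) : hahnFun q n x a b N = √(hahnWeight q x a b N / hahnNorm q n a b N) *
      hahnPoly q (q ^ (a + 1)) (q ^ (b + 1)) n (q ^ x)⁻¹ (q ^ N)⁻¹ := by
  rw [hahnFun, if_pos ⟨by positivity, by exact_mod_cast hx, by exact_mod_cast hn⟩,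
    Int.toNat_natCast, Int.toNat_natCast, hahn_eq_hahnPoly hq0 hq1 b ha hn]

theorem hahnFun_eq_zero {n : ℕ} {x N : ℤ} (h : x < 0 ∨ N < x ∨ N < n) :
    hahnFun q n x a b N = 0 := if_neg (by omega)

theorem sqrt_mul_sqrt_eq {u v c w : ℝ} (hu : 0 ≤ u) (hc : 0 ≤ c) (h : u * v = c ^ 2 * w) :
    √u * √v = c * √w := by
  rw [← Real.sqrt_mul hu, h, Real.sqrt_mul (sq_nonneg c), Real.sqrt_sq hc]

/-- The eigenvalue of `q^{A_0}` is split so that `√(q^{a+1})` can be merged into the square root of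
the weight. -/
theorem rpow_add_half (hq0 : 0 < q) (a : ℝ) (x : ℕ) :
    q ^ ((x : ℝ) + (a + 1) / 2) = q ^ x * √(q ^ (a + 1)) := by
  rw [Real.rpow_add hq0, Real.rpow_natCast, Real.sqrt_eq_rpow, ← Real.rpow_mul hq0.le]
  congr 2
  ring

theorem rpow_two_mul_add (hq0 : 0 < q) (a b : ℝ) (n : ℕ) :
    q ^ (2 * (n : ℝ) + a + b + 1 + 1) = q ^ (a + 1) * q ^ (b + 1) * q ^ (2 * n) := by
  rw [← Real.rpow_natCast, ← Real.rpow_add hq0, ← Real.rpow_add hq0]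
  congr 1
  push_cast
  ring

/-- This is the action of the coproduct of `A_+` on a Clebsch–Gordan vector, read off at the basis
vector `e_x ⊗ e_{N+1-x}`. It is `hahnPoly_raising` at `X = q^{-x}`, `Z = q^{-(N+1)}`. -/
theorem hahnFun_raising (hq0 : 0 < q) (hq1 : q < 1) (ha : 0 < a) (hb : 0 < b) {n x N : ℕ}
    (hx : x ≤ N + 1) (hn : n ≤ N + 1) :
    √(sigma q a x) * hahnFun q n ((x : ℤ) - 1) a b N
      + q ^ ((x : ℝ) + (a + 1) / 2) * √(sigma q b (N + 1 - x)) * hahnFun q n x a b N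
    = √(sigma q (2 * n + a + b + 1) (N + 1 - n)) * hahnFun q n x a b ((N : ℤ) + 1) := by
  rcases Nat.lt_or_ge N n with h | h
  -- No vector of degree `n = N + 1` exists one level below, and `σ_0 = 0` kills the right side.
  · obtain rfl : n = N + 1 := by omega
    rw [hahnFun_eq_zero (by omega), hahnFun_eq_zero (by omega), Nat.sub_self, sigma_zero]
    simp
  set s := ladderScale q with hs
  have hs0 : 0 ≤ s := ladderScale_nonneg hq1
  have hη := hahnNorm_pos hq0 hq1 ha hb n N
  have hη' := hahnNorm_pos hq0 hq1 ha hb n (N + 1)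
  have hA0 : 0 < q ^ (a + 1) := Real.rpow_pos_of_pos hq0 _
  -- All three terms are brought to the common radical `√(ω(x; N+1) / η(n; N))`, using the one-step
  -- ratios of weight and norm.
  have e1 : √(sigma q a x) * hahnFun q n ((x : ℤ) - 1) a b N =
      s * (1 - q ^ x) * √(hahnWeight q x a b (N + 1) / hahnNorm q n a b N) *
        hahnPoly q (q ^ (a + 1)) (q ^ (b + 1)) n (q * (q ^ x)⁻¹) (q * (q ^ (N + 1))⁻¹) := by
    rcases x with _ | x
    · simp [sigma_zero]
    · have hx' : x ≤ N := by omega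
      rw [show ((x + 1 : ℕ) : ℤ) - 1 = x by push_cast; ring, hahnFun_natCast hq0 hq1 ha hx' h,
        ← mul_assoc, sqrt_mul_sqrt_eq (sigma_nonneg hq0 hq1 ha _)
          (mul_nonneg hs0 (one_sub_pow_nonneg hq0 hq1 (x + 1)))
          (w := hahnWeight q (x + 1) a b (N + 1) / hahnNorm q n a b N)]
      · congr 2 <;> · field_simp; ring
      · rw [sigma_succ hq0, ← hs]
        have := hahnWeight_succ_succ hq0 hq1 a b hx'
        linear_combination -s ^ 2 * (1 - q ^ (x + 1)) * (hahnNorm q n a b N)⁻¹ * this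
  have e2 : q ^ ((x : ℝ) + (a + 1) / 2) * √(sigma q b (N + 1 - x)) * hahnFun q n x a b N =
      s * (q ^ x * (1 - q ^ (N + 1 - x))) *
        √(hahnWeight q x a b (N + 1) / hahnNorm q n a b N) *
        hahnPoly q (q ^ (a + 1)) (q ^ (b + 1)) n (q ^ x)⁻¹ (q * (q ^ (N + 1))⁻¹) := by
    rcases Nat.lt_or_ge N x with hx' | hx'
    · obtain rfl : x = N + 1 := by omega
      simp [sigma_zero]
    · rw [hahnFun_natCast hq0 hq1 ha hx' h, rpow_add_half hq0]
      have : √(q ^ (a + 1)) * √(sigma q b (N + 1 - x)) *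
          √(hahnWeight q x a b N / hahnNorm q n a b N) = s * (1 - q ^ (N + 1 - x)) *
          √(hahnWeight q x a b (N + 1) / hahnNorm q n a b N) := by
        rw [← Real.sqrt_mul hA0.le]
        refine sqrt_mul_sqrt_eq (mul_nonneg hA0.le (sigma_nonneg hq0 hq1 hb _))
          (mul_nonneg hs0 (one_sub_pow_nonneg hq0 hq1 _)) ?_
        rw [show N + 1 - x = N - x + 1 by omega, sigma_succ hq0, ← hs,
          show N - x + 1 = N + 1 - x by omega]
        have := hahnWeight_succ hq0 hq1 a b hx'
        linear_combination -s ^ 2 * (1 - q ^ (N + 1 - x)) * (hahnNorm q n a b N)⁻¹ * this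
      rw [show q * (q ^ (N + 1))⁻¹ = (q ^ N)⁻¹ by field_simp; ring]
      linear_combination q ^ x * hahnPoly q (q ^ (a + 1)) (q ^ (b + 1)) n (q ^ x)⁻¹ (q ^ N)⁻¹ * this
  have e3 : √(sigma q (2 * n + a + b + 1) (N + 1 - n)) * hahnFun q n x a b ((N : ℤ) + 1) =
      s * (q ^ n * (1 - q ^ (N + 1 - n))) *
        √(hahnWeight q x a b (N + 1) / hahnNorm q n a b N) *
        hahnPoly q (q ^ (a + 1)) (q ^ (b + 1)) n (q ^ x)⁻¹ (q ^ (N + 1))⁻¹ := by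
    rw [show (N : ℤ) + 1 = (N + 1 : ℕ) by push_cast; ring, hahnFun_natCast hq0 hq1 ha hx hn,
      ← mul_assoc, sqrt_mul_sqrt_eq (sigma_nonneg hq0 hq1 (by positivity) _)
        (mul_nonneg hs0 (mul_nonneg (pow_pos hq0 n).le (one_sub_pow_nonneg hq0 hq1 _)))]
    rw [show N + 1 - n = N - n + 1 by omega, sigma_succ hq0, ← hs,
      show N - n + 1 = N + 1 - n by omega, rpow_two_mul_add hq0]
    have := hahnNorm_succ hq0 hq1 a b h
    have hp : q ^ (2 * n) * q ^ (N - n) = q ^ (N + n) := by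
      rw [← pow_add]; congr 1; omega
    rw [mul_assoc (q ^ (a + 1) * q ^ (b + 1)), hp]
    field_simp
    linear_combination -s ^ 2 * (1 - q ^ (N + 1 - n)) * hahnWeight q x a b (N + 1) * this
  rw [e1, e2, e3]
  have hp := hahnPoly_raising q (q ^ (a + 1)) (q ^ (b + 1)) n (q ^ x)⁻¹ (q ^ (N + 1))⁻¹
  obtain ⟨r, hr⟩ := Nat.exists_eq_add_of_le hx
  obtain ⟨t, ht⟩ := Nat.exists_eq_add_of_le hn
  -- Multiplying the polynomial relation by `q^{N+1} q^x` turns its coefficients into those of `e1`,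
  -- `e2`, `e3`.
  have c1 : (q ^ (N + 1) * q ^ x) * (((q ^ x)⁻¹ - 1) * (q ^ (N + 1))⁻¹) = 1 - q ^ x := by
    field_simp
  have c2 : (q ^ (N + 1) * q ^ x) * ((q ^ (N + 1))⁻¹ - (q ^ x)⁻¹)
      = q ^ x * (1 - q ^ (N + 1 - x)) := by
    rw [hr, Nat.add_sub_cancel_left, pow_add]
    field_simp
  have c3 : (q ^ (N + 1) * q ^ x) * ((q ^ x)⁻¹ * (q ^ n * (q ^ (N + 1))⁻¹ - 1))
      = q ^ n * (1 - q ^ (N + 1 - n)) := by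
    rw [ht, Nat.add_sub_cancel_left, pow_add]
    field_simp
  rw [← c1, ← c2, ← c3]
  linear_combination s * √(hahnWeight q x a b (N + 1) / hahnNorm q n a b N) *
    (q ^ (N + 1) * q ^ x) * hp

/-- The counterpart for `A_-`, obtained from `hahnPoly_lowering` at `X = q^{-(x+1)}`, `Z =
q^{-(N+1)}`. For `n = N + 1` the right side is zero: that vector is of lowest weight. -/
theorem hahnFun_lowering (hq0 : 0 < q) (hq1 : q < 1) (ha : 0 < a) (hb : 0 < b) {n x N : ℕ}
    (hx : x ≤ N) (hn : n ≤ N + 1) :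
    √(sigma q a (x + 1)) * hahnFun q n ((x : ℤ) + 1) a b ((N : ℤ) + 1)
      + q ^ ((x : ℝ) + (a + 1) / 2) * √(sigma q b (N + 1 - x)) *
        hahnFun q n x a b ((N : ℤ) + 1)
    = √(sigma q (2 * n + a + b + 1) (N + 1 - n)) * hahnFun q n x a b N := by
  set s := ladderScale q with hs
  have hs0 : 0 ≤ s := ladderScale_nonneg hq1
  have hη := hahnNorm_pos hq0 hq1 ha hb n N
  have hη' := hahnNorm_pos hq0 hq1 ha hb n (N + 1)
  have hA0 : 0 < q ^ (a + 1) := Real.rpow_pos_of_pos hq0 _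
  have hA1 : q ^ (a + 1) < 1 := Real.rpow_lt_one hq0.le hq1 (by linarith)
  have hB0 : 0 < q ^ (b + 1) := Real.rpow_pos_of_pos hq0 _
  have hB1 : q ^ (b + 1) < 1 := Real.rpow_lt_one hq0.le hq1 (by linarith)
  have hAB : q ^ (a + 1) * q ^ (b + 1) < 1 := by nlinarith
  set w := √(hahnWeight q x a b N / hahnNorm q n a b (N + 1)) with hw
  have e1 : √(sigma q a (x + 1)) * hahnFun q n ((x : ℤ) + 1) a b ((N : ℤ) + 1) =
      s * (1 - q ^ (a + 1) * q ^ x) * w *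
        hahnPoly q (q ^ (a + 1)) (q ^ (b + 1)) n (q ^ (x + 1))⁻¹ (q ^ (N + 1))⁻¹ := by
    rw [show (x : ℤ) + 1 = (x + 1 : ℕ) by push_cast; ring,
      show (N : ℤ) + 1 = (N + 1 : ℕ) by push_cast; ring,
      hahnFun_natCast hq0 hq1 ha (by omega) hn, ← mul_assoc,
      sqrt_mul_sqrt_eq (sigma_nonneg hq0 hq1 ha _)
        (mul_nonneg hs0 (one_sub_mul_pow_pos hq0 hq1 hA1 x).le)]
    rw [sigma_succ hq0, ← hs]
    have := hahnWeight_succ_succ hq0 hq1 a b hx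
    linear_combination s ^ 2 * (1 - q ^ (a + 1) * q ^ x) * (hahnNorm q n a b (N + 1))⁻¹ * this
  have e2 : q ^ ((x : ℝ) + (a + 1) / 2) * √(sigma q b (N + 1 - x)) *
      hahnFun q n x a b ((N : ℤ) + 1) =
      s * (q ^ x * (q ^ (a + 1) * (1 - q ^ (b + 1) * q ^ (N - x)))) * w *
        hahnPoly q (q ^ (a + 1)) (q ^ (b + 1)) n (q ^ x)⁻¹ (q ^ (N + 1))⁻¹ := by
    rw [show (N : ℤ) + 1 = (N + 1 : ℕ) by push_cast; ring,
      hahnFun_natCast hq0 hq1 ha (by omega) hn, rpow_add_half hq0]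
    have : √(q ^ (a + 1)) * √(sigma q b (N + 1 - x)) *
        √(hahnWeight q x a b (N + 1) / hahnNorm q n a b (N + 1)) =
        s * (q ^ (a + 1) * (1 - q ^ (b + 1) * q ^ (N - x))) * w := by
      rw [← Real.sqrt_mul hA0.le]
      refine sqrt_mul_sqrt_eq (mul_nonneg hA0.le (sigma_nonneg hq0 hq1 hb _))
        (mul_nonneg hs0 (mul_nonneg hA0.le (one_sub_mul_pow_pos hq0 hq1 hB1 _).le)) ?_
      rw [show N + 1 - x = N - x + 1 by omega, sigma_succ hq0, ← hs,
        show N - x + 1 = N + 1 - x by omega]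
      have := hahnWeight_succ hq0 hq1 a b hx
      linear_combination s ^ 2 * q ^ (a + 1) * (1 - q ^ (b + 1) * q ^ (N - x)) *
        (hahnNorm q n a b (N + 1))⁻¹ * this
    linear_combination q ^ x *
      hahnPoly q (q ^ (a + 1)) (q ^ (b + 1)) n (q ^ x)⁻¹ (q ^ (N + 1))⁻¹ * this
  have e3 : √(sigma q (2 * n + a + b + 1) (N + 1 - n)) * hahnFun q n x a b N =
      s * ((q ^ n)⁻¹ * (1 - q ^ (a + 1) * q ^ (b + 1) * q ^ (N + n))) * w *
        hahnPoly q (q ^ (a + 1)) (q ^ (b + 1)) n (q ^ x)⁻¹ (q ^ N)⁻¹ := by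
    rcases Nat.lt_or_ge N n with h | h
    -- On the left `σ_0 = 0`; on the right the polynomial of degree `N + 1` vanishes at all lattice
    -- points.
    · obtain rfl : n = N + 1 := by omega
      rw [hahnPoly_eq_zero hq0 _ _ hx, Nat.sub_self, sigma_zero]
      simp
    rw [hahnFun_natCast hq0 hq1 ha hx h, ← mul_assoc,
      sqrt_mul_sqrt_eq (sigma_nonneg hq0 hq1 (by positivity) _)
        (mul_nonneg hs0 (mul_nonneg (inv_pos.2 (pow_pos hq0 n)).le
          (one_sub_mul_pow_pos hq0 hq1 hAB _).le))]
    rw [show N + 1 - n = N - n + 1 by omega, sigma_succ hq0, ← hs,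
      show N - n + 1 = N + 1 - n by omega, rpow_two_mul_add hq0]
    have := hahnNorm_succ hq0 hq1 a b h
    have hp : q ^ (2 * n) * q ^ (N - n) = q ^ (N + n) := by
      rw [← pow_add]; congr 1; omega
    rw [mul_assoc (q ^ (a + 1) * q ^ (b + 1)), hp]
    generalize 1 - q ^ (a + 1) * q ^ (b + 1) * q ^ (N + n) = c at *
    field_simp
    linear_combination s ^ 2 * c * hahnWeight q x a b N * this
  rw [e1, e2, e3]
  have hp := hahnPoly_lowering hq0 hq1 (q ^ (a + 1)) (q ^ (b + 1)) n (q ^ (x + 1))⁻¹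
    (q ^ (N + 1))⁻¹
  rw [show q * (q ^ (x + 1))⁻¹ = (q ^ x)⁻¹ by field_simp; ring,
    show q * (q ^ (N + 1))⁻¹ = (q ^ N)⁻¹ by field_simp; ring] at hp
  obtain ⟨r, hr⟩ := Nat.exists_eq_add_of_le hx
  have c1 : (q ^ (N + 1) * q ^ x) * ((q ^ (N + 1))⁻¹ * ((q ^ x)⁻¹ - q ^ (a + 1))) =
      1 - q ^ (a + 1) * q ^ x := by
    field_simp
  have c2 : (q ^ (N + 1) * q ^ x) * (q ^ (a + 1) *
      ((q ^ (N + 1))⁻¹ - q ^ (b + 1) * (q ^ (x + 1))⁻¹))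
      = q ^ x * (q ^ (a + 1) * (1 - q ^ (b + 1) * q ^ (N - x))) := by
    rw [hr, Nat.add_sub_cancel_left, pow_succ, pow_add, pow_succ]
    field_simp
  have c3 : (q ^ (N + 1) * q ^ x) * ((q ^ n)⁻¹ * (q ^ (x + 1))⁻¹ *
      ((q ^ N)⁻¹ - q ^ (a + 1) * q ^ (b + 1) * q ^ n))
      = (q ^ n)⁻¹ * (1 - q ^ (a + 1) * q ^ (b + 1) * q ^ (N + n)) := by
    field_simp
    ring
  rw [← c1, ← c2, ← c3]
  linear_combination s * w * (q ^ (N + 1) * q ^ x) * hp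

end SuQ
namespace SuQ

/-! ### Orthonormality of the `q`-Hahn functions. -/

variable {q a b : ℝ}

/-- Squaring removes the sign `(-1)^n` that comes from reversing the product. -/
theorem qPoch_inv_pow_self_sq (hq0 : 0 < q) (n : ℕ) :
    qPoch (q ^ n)⁻¹ q n ^ 2 * q ^ (n * (n + 1)) = qPoch q q n ^ 2 := by
  induction n with
  | zero => simp [qPoch_zero]
  | succ n ih =>
    rw [qPoch_succ', qPoch_succ, show (q ^ (n + 1))⁻¹ * q = (q ^ n)⁻¹ by field_simp; ring,
      mul_pow, mul_pow, ← ih, show (n + 1) * (n + 1 + 1) = n * (n + 1) + (n + 1) * 2 by ring,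
      pow_add q (n * (n + 1)), pow_mul q (n + 1) 2]
    have : (1 - (q ^ (n + 1))⁻¹) ^ 2 * (q ^ (n + 1)) ^ 2 = (1 - q * q ^ n) ^ 2 := by
      field_simp; ring
    linear_combination qPoch (q ^ n)⁻¹ q n ^ 2 * q ^ (n * (n + 1)) * this

theorem hahnPoly_one (q A B : ℝ) (n : ℕ) (Z : ℝ) :
    hahnPoly q A B n 1 Z = qPoch A q n * qPoch Z q n := by
  rw [hahnPoly, Finset.sum_eq_single_of_mem 0 (by simp)]
  · simp [hahnCoeff, qPoch_zero]
  · intro k _ hk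
    obtain ⟨k, rfl⟩ := Nat.exists_eq_succ_of_ne_zero hk
    simp [qPoch_succ']

theorem hahnFun_self_zero_sq (hq0 : 0 < q) (hq1 : q < 1) (ha : 0 < a) (hb : 0 < b) (n : ℕ) :
    hahnFun q n (0 : ℕ) a b n ^ 2 *
        ∏ i ∈ Finset.range n, (1 - q ^ (a + 1) * q ^ (b + 1) * q ^ (n - 1 + i))
      = qPoch (q ^ (a + 1)) q n := by
  set A := q ^ (a + 1) with hA
  set B := q ^ (b + 1) with hB
  set C := q ^ (a + b + 1) with hC
  have hABC : A * B = C * q := by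
    rw [hA, hB, hC, ← Real.rpow_add hq0, ← Real.rpow_add_one hq0.ne']; congr 1; ring
  have hA1 : A < 1 := Real.rpow_lt_one hq0.le hq1 (by linarith)
  have hB1 : B < 1 := Real.rpow_lt_one hq0.le hq1 (by linarith)
  have hC1 : C < 1 := Real.rpow_lt_one hq0.le hq1 (by linarith)
  have hA0 : 0 < A := Real.rpow_pos_of_pos hq0 _
  have hprod : ∏ i ∈ Finset.range n, (1 - A * B * q ^ (n - 1 + i)) = qPoch (C * q ^ n) q n := by
    refine Finset.prod_congr rfl fun i hi => ?_
    have := Finset.mem_range.1 hi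
    obtain ⟨m, rfl⟩ := Nat.exists_eq_succ_of_ne_zero (show n ≠ 0 by omega)
    rw [hABC, Nat.succ_eq_add_one, Nat.add_sub_cancel, pow_add, pow_succ]
    ring
  have hC2 : q ^ (2 * (n : ℝ) + a + b + 1) = C * q ^ (n + n) := by
    rw [hC, ← Real.rpow_natCast, ← Real.rpow_add hq0]; congr 1; push_cast; ring
  have h1 : (1 - C) * qPoch (A * B) q (n + n) =
      qPoch C q n * qPoch (C * q ^ n) q n * (1 - C * q ^ (n + n)) := by
    rw [hABC, ← qPoch_succ', qPoch_succ, qPoch_add]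
  have hd : 0 < 1 - C * q ^ (n + n) := one_sub_mul_pow_pos hq0 hq1 hC1 _
  have hη := hahnNorm_eq hq0 a b n 0
  have hω := hahnWeight_eq hq0 a b 0 n
  have hη0 := hahnNorm_pos hq0 hq1 ha hb n n
  have hω0 := hahnWeight_pos hq0 hq1 ha hb 0 n
  rw [hprod, hahnFun_natCast hq0 hq1 ha (Nat.zero_le n) le_rfl, mul_pow, Real.sq_sqrt (by positivity),
    pow_zero, inv_one, hahnPoly_one]
  have e : (qPoch A q n * qPoch (q ^ n)⁻¹ q n) ^ 2 =
      qPoch A q n ^ 2 * qPoch q q n ^ 2 * (q ^ (n * (n + 1)))⁻¹ := by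
    rw [← qPoch_inv_pow_self_sq hq0]; field_simp
  rw [e, div_mul_eq_mul_div, div_mul_eq_mul_div, div_eq_iff hη0.ne']
  simp only [add_zero, zero_add, qPoch_zero, mul_zero, pow_zero] at hη hω
  rw [hη, hω, hC2, ← hA, ← hB, ← hC]
  have p1 := (qPoch_pos hq0 hq1 hC1 n).ne'
  have p2 := (qPoch_pos hq0 hq1 hq1 n).ne'
  have p3 := (pow_pos hq0 (n * (n + 1))).ne'
  generalize 1 - C * q ^ (n + n) = d at *
  generalize qPoch C q n = c at *
  generalize qPoch q q n = e at *
  generalize q ^ (n * (n + 1)) = f at *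
  have hd' := hd.ne'
  field_simp
  linear_combination -qPoch B q n * qPoch A q n ^ 2 * h1

/-- The vector with `n = N` is annihilated by `A_-`, so `hahnFun_lowering` becomes a two-term
recurrence in `x`. Its square determines all squared coefficients from the one at `x = 0`, and they
are the summands of `sum_gaussBinom`. -/
theorem hahnFun_self_sq (hq0 : 0 < q) (hq1 : q < 1) (ha : 0 < a) (hb : 0 < b) {n x : ℕ}
    (hx : x ≤ n) :
    hahnFun q n x a b n ^ 2 *
        ∏ i ∈ Finset.range n, (1 - q ^ (a + 1) * q ^ (b + 1) * q ^ (n - 1 + i))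
      = gaussBinom q n x * qPoch (q ^ (a + 1) * q ^ x) q (n - x) *
        qPoch (q ^ (b + 1) * q ^ (n - x)) q x * q ^ (x * (x - 1)) * (q ^ (a + 1)) ^ x := by
  induction x with
  | zero =>
    rw [hahnFun_self_zero_sq hq0 hq1 ha hb]
    simp [gaussBinom_zero_right, qPoch_zero]
  | succ x ih =>
    obtain ⟨r, rfl⟩ : ∃ r, n = x + 1 + r := Nat.exists_eq_add_of_le hx
    have h := hahnFun_lowering hq0 hq1 ha hb (n := x + r + 1) (x := x) (N := x + r)
      (by omega) le_rfl
    have ih := ih (by omega)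
    rw [Nat.sub_self, sigma_zero, Real.sqrt_zero, zero_mul,
      show ((x + r : ℕ) : ℤ) + 1 = (x + 1 + r : ℕ) by push_cast; ring,
      show (x : ℤ) + 1 = (x + 1 : ℕ) by push_cast; ring,
      show x + r + 1 = x + 1 + r by omega, rpow_add_half hq0] at h
    have hA0 : 0 < q ^ (a + 1) := Real.rpow_pos_of_pos hq0 _
    have hA1 : q ^ (a + 1) < 1 := Real.rpow_lt_one hq0.le hq1 (by linarith)
    have hsq : sigma q a (x + 1) * hahnFun q (x + 1 + r) (x + 1 : ℕ) a b (x + 1 + r : ℕ) ^ 2 =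
        (q ^ x) ^ 2 * q ^ (a + 1) * sigma q b (x + 1 + r - x) *
          hahnFun q (x + 1 + r) x a b (x + 1 + r : ℕ) ^ 2 := by
      rw [← Real.sq_sqrt (sigma_nonneg hq0 hq1 ha (x + 1)),
        ← Real.sq_sqrt (sigma_nonneg hq0 hq1 hb (x + 1 + r - x))]
      linear_combination (√(sigma q a (x + 1)) *
        hahnFun q (x + 1 + r) (x + 1 : ℕ) a b (x + 1 + r : ℕ) - q ^ x * √(q ^ (a + 1)) *
        √(sigma q b (x + 1 + r - x)) * hahnFun q (x + 1 + r) x a b (x + 1 + r : ℕ)) * h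
        + q ^ (x * 2) * √(sigma q b (x + 1 + r - x)) ^ 2 *
          hahnFun q (x + 1 + r) x a b (x + 1 + r : ℕ) ^ 2 * Real.sq_sqrt hA0.le
    have e1 : x + 1 + r - x = r + 1 := by omega
    have e2 : x + 1 + r - (x + 1) = r := by omega
    have hσ := (sigma_pos hq0 hq1 ha (Nat.succ_ne_zero x)).ne'
    rw [e1] at ih hsq
    rw [e2]
    refine mul_left_cancel₀ hσ ?_
    rw [← mul_assoc, Nat.succ_eq_add_one, hsq]
    have g : gaussBinom q (x + 1 + r) (x + 1) * (1 - q ^ (x + 1)) =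
        gaussBinom q (x + 1 + r) x * (1 - q ^ (r + 1)) := by
      have h1 := gaussBinom_mul q (x + 1) r
      have h2 := gaussBinom_mul q x (r + 1)
      rw [show x + (r + 1) = x + 1 + r by omega, ← h1, qPoch_succ, qPoch_succ] at h2
      have p1 := (qPoch_pos hq0 hq1 hq1 x).ne'
      have p2 := (qPoch_pos hq0 hq1 hq1 r).ne'
      refine mul_left_cancel₀ (mul_ne_zero p1 p2) ?_
      linear_combination -h2
    have hpow : q ^ ((x + 1) * (x + 1 - 1)) = q ^ (x * (x - 1)) * (q ^ x) ^ 2 := by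
      rcases x with _ | x
      · simp
      · rw [← pow_mul, ← pow_add, Nat.add_sub_cancel, Nat.add_sub_cancel]; congr 1; ring
    rw [qPoch_succ' (q ^ (a + 1) * q ^ x)] at ih
    rw [sigma_succ hq0, sigma_succ hq0, hpow, qPoch_succ' (q ^ (b + 1) * q ^ r), pow_succ q x,
      ← mul_assoc (q ^ (a + 1)), pow_succ (q ^ (a + 1)) x]
    rw [pow_succ q r, ← mul_assoc (q ^ (b + 1))] at ih
    rw [← pow_succ q x]
    generalize ladderScale q ^ 2 = s
    generalize hahnFun q (x + 1 + r) x a b (x + 1 + r : ℕ) = u at *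
    linear_combination (q ^ x) ^ 2 * q ^ (a + 1) * s * (1 - q ^ (r + 1)) *
      (1 - q ^ (b + 1) * q ^ r) * ih - s * (1 - q ^ (a + 1) * q ^ x) *
      qPoch (q ^ (a + 1) * q ^ x * q) q r * (1 - q ^ (b + 1) * q ^ r) *
      qPoch (q ^ (b + 1) * q ^ r * q) q x * q ^ (x * (x - 1)) * (q ^ x) ^ 2 *
      (q ^ (a + 1)) ^ x * q ^ (a + 1) * g

theorem sum_hahnFun_self_sq (hq0 : 0 < q) (hq1 : q < 1) (ha : 0 < a) (hb : 0 < b) (n : ℕ) :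
    ∑ x ∈ Finset.range (n + 1), hahnFun q n x a b n * hahnFun q n x a b n = 1 := by
  have hp : ∏ i ∈ Finset.range n, (1 - q ^ (a + 1) * q ^ (b + 1) * q ^ (n - 1 + i)) ≠ 0 := by
    have hA0 : 0 < q ^ (a + 1) := Real.rpow_pos_of_pos hq0 _
    have hA1 : q ^ (a + 1) < 1 := Real.rpow_lt_one hq0.le hq1 (by linarith)
    have hB0 : 0 < q ^ (b + 1) := Real.rpow_pos_of_pos hq0 _
    have hB1 : q ^ (b + 1) < 1 := Real.rpow_lt_one hq0.le hq1 (by linarith)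
    exact Finset.prod_ne_zero_iff.2 fun i _ =>
      (one_sub_mul_pow_pos hq0 hq1 (by nlinarith) _).ne'
  refine mul_right_cancel₀ hp ?_
  conv_rhs => rw [one_mul, ← sum_gaussBinom]
  rw [Finset.sum_mul]
  refine Finset.sum_congr rfl fun x hx => ?_
  rw [← sq, hahnFun_self_sq hq0 hq1 ha hb (Nat.lt_succ_iff.1 (Finset.mem_range.1 hx))]

/-- Adjointness of `A_+` and `A_-`: the inner product of `A_+ v_n` in degree `N + 1` with `v_m`
equals that of `v_n` in degree `N` with `A_- v_m`. -/
theorem sum_hahnFun_ladder (hq0 : 0 < q) (hq1 : q < 1) (ha : 0 < a) (hb : 0 < b) {n m N : ℕ}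
    (hn : n ≤ N + 1) (hm : m ≤ N + 1) :
    √(sigma q (2 * n + a + b + 1) (N + 1 - n)) * ∑ x ∈ Finset.range (N + 1 + 1),
        hahnFun q n x a b ((N + 1 : ℕ) : ℤ) * hahnFun q m x a b ((N + 1 : ℕ) : ℤ)
      = √(sigma q (2 * m + a + b + 1) (N + 1 - m)) * ∑ x ∈ Finset.range (N + 1),
        hahnFun q n x a b N * hahnFun q m x a b N := by
  rw [show ((N + 1 : ℕ) : ℤ) = (N : ℤ) + 1 by push_cast; ring, Finset.mul_sum, Finset.mul_sum]
  have h1 : ∀ x ∈ Finset.range (N + 1 + 1), √(sigma q (2 * n + a + b + 1) (N + 1 - n)) *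
      (hahnFun q n x a b ((N : ℤ) + 1) * hahnFun q m x a b ((N : ℤ) + 1)) =
      √(sigma q a x) * hahnFun q n ((x : ℤ) - 1) a b N * hahnFun q m x a b ((N : ℤ) + 1) +
      q ^ ((x : ℝ) + (a + 1) / 2) * √(sigma q b (N + 1 - x)) * hahnFun q n x a b N *
        hahnFun q m x a b ((N : ℤ) + 1) := fun x hx => by
    rw [← mul_assoc,
      ← hahnFun_raising hq0 hq1 ha hb (Nat.lt_succ_iff.1 (Finset.mem_range.1 hx)) hn, add_mul]
  -- The shifted sum loses its term `x = 0` and the other its term `x = N + 1`, both through `σ_0 =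
  -- 0`.
  rw [Finset.sum_congr rfl h1, Finset.sum_add_distrib, Finset.sum_range_succ',
    Finset.sum_range_succ _ (N + 1)]
  simp only [sigma_zero, Nat.sub_self, Real.sqrt_zero, zero_mul, mul_zero, add_zero]
  rw [← Finset.sum_add_distrib]
  refine Finset.sum_congr rfl fun x hx => ?_
  have h2 := hahnFun_lowering hq0 hq1 ha hb (Nat.lt_succ_iff.1 (Finset.mem_range.1 hx)) hm
  rw [mul_left_comm, ← h2]
  push_cast
  rw [add_sub_cancel_right]
  ring

/-- The `q`-Hahn functions are orthonormal. -/
theorem sum_hahnFun_mul (hq0 : 0 < q) (hq1 : q < 1) (ha : 0 < a) (hb : 0 < b) {n m N : ℕ}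
    (hn : n ≤ N) (hm : m ≤ N) :
    ∑ x ∈ Finset.range (N + 1), hahnFun q n x a b N * hahnFun q m x a b N =
      if n = m then 1 else 0 := by
  induction N generalizing n m with
  | zero =>
    obtain rfl : n = 0 := by omega
    obtain rfl : m = 0 := by omega
    rw [if_pos rfl]
    exact sum_hahnFun_self_sq hq0 hq1 ha hb 0
  | succ N ih =>
    have main : ∀ {n m : ℕ}, n ≤ N → m ≤ N + 1 → ∑ x ∈ Finset.range (N + 1 + 1),
        hahnFun q n x a b ((N + 1 : ℕ) : ℤ) * hahnFun q m x a b ((N + 1 : ℕ) : ℤ) =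
        if n = m then 1 else 0 := by
      intro n m hn hm
      have h := sum_hahnFun_ladder hq0 hq1 ha hb (show n ≤ N + 1 by omega) hm
      -- For `n ≤ N` this factor is nonzero, so inner products in degree `N + 1` are determined by
      -- those in degree `N`. For `m = N + 1` the other factor is `√σ_0 = 0`, and for `n = m` the
      -- two factors agree.
      have hσ : √(sigma q (2 * n + a + b + 1) (N + 1 - n)) ≠ 0 :=
        (Real.sqrt_pos.2 (sigma_pos hq0 hq1 (by positivity) (by omega))).ne'
      refine mul_left_cancel₀ hσ (h.trans ?_)
      rcases Nat.lt_or_ge N m with h' | h'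
      · obtain rfl : m = N + 1 := by omega
        rw [Nat.sub_self, sigma_zero, if_neg (by omega)]
        simp
      · rw [ih hn h']
        split_ifs with e
        · rw [e]
        · simp
    rcases Nat.lt_or_ge N n with h | h
    · obtain rfl : n = N + 1 := by omega
      rcases Nat.lt_or_ge N m with h' | h'
      · obtain rfl : m = N + 1 := by omega
        rw [if_pos rfl]
        exact sum_hahnFun_self_sq hq0 hq1 ha hb (N + 1)
      · simp_rw [mul_comm (hahnFun q (N + 1) _ a b _), main h' hn, eq_comm]
    · exact main h hm

end SuQ
namespace SuQ

/-! ### Action of `A_±^{[1;k]}` on the partial products of `Psi`. -/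

section Ladder

variable {q a b : ℝ}

theorem hahnFun_raising_add (hq0 : 0 < q) (hq1 : q < 1) (ha : 0 < a) (hb : 0 < b) (n x y : ℕ) :
    √(sigma q a x) * hahnFun q n ((x : ℤ) - 1) a b ((x : ℤ) + y - 1)
      + q ^ ((x : ℝ) + (a + 1) / 2) * √(sigma q b y) * hahnFun q n x a b ((x : ℤ) + y - 1)
    = √(sigma q (2 * n + a + b + 1) (x + y - n)) * hahnFun q n x a b ((x : ℤ) + y) := by
  rcases Nat.lt_or_ge (x + y) n with hn | hn
  · rw [hahnFun_eq_zero (by omega), hahnFun_eq_zero (by omega), hahnFun_eq_zero (by omega)]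
    simp
  rcases Nat.eq_zero_or_pos (x + y) with h0 | h0
  · obtain ⟨rfl, rfl⟩ : x = 0 ∧ y = 0 := by omega
    simp [sigma_zero]
  · obtain ⟨N, hN⟩ : ∃ N, x + y = N + 1 := ⟨x + y - 1, by omega⟩
    have h := hahnFun_raising hq0 hq1 ha hb (n := n) (x := x) (N := N) (by omega) (by omega)
    rw [show (x : ℤ) + y - 1 = N by omega, show (x : ℤ) + y = (N : ℤ) + 1 by omega, hN]
    rwa [show N + 1 - x = y by omega] at h

theorem hahnFun_lowering_add (hq0 : 0 < q) (hq1 : q < 1) (ha : 0 < a) (hb : 0 < b) (n x y : ℕ) :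
    √(sigma q a (x + 1)) * hahnFun q n ((x : ℤ) + 1) a b ((x : ℤ) + y + 1)
      + q ^ ((x : ℝ) + (a + 1) / 2) * √(sigma q b (y + 1)) * hahnFun q n x a b ((x : ℤ) + y + 1)
    = √(sigma q (2 * n + a + b + 1) (x + y - n + 1)) * hahnFun q n x a b ((x : ℤ) + y) := by
  rcases Nat.lt_or_ge (x + y + 1) n with hn | hn
  · rw [hahnFun_eq_zero (by omega), hahnFun_eq_zero (by omega), hahnFun_eq_zero (by omega)]
    simp
  have h := hahnFun_lowering hq0 hq1 ha hb (n := n) (x := x) (N := x + y) (by omega) hn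
  rw [show x + y + 1 - x = y + 1 by omega] at h
  push_cast at h
  rw [h]
  rcases Nat.lt_or_ge (x + y) n with hn' | hn'
  · rw [hahnFun_eq_zero (by omega)]
    simp
  · rw [show x + y + 1 - n = x + y - n + 1 by omega]

end Ladder

variable {d : ℕ}

theorem mem_initialSet {k : ℕ} {i : Fin d} : i ∈ initialSet d k ↔ i.val < k := by
  simp [initialSet]

theorem psum_eq_sum {M : Type*} [AddCommMonoid M] (v : Fin d → M) (k : ℕ) :
    psum v k = ∑ i ∈ initialSet d k, v i := rfl

theorem psum_zero {M : Type*} [AddCommMonoid M] (v : Fin d → M) : psum v 0 = 0 := by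
  simp [psum]

theorem initialSet_self (d : ℕ) : initialSet d d = Finset.univ := by
  ext i; simp [mem_initialSet]

theorem psum_self {M : Type*} [AddCommMonoid M] (v : Fin d → M) : psum v d = ∑ i, v i := by
  rw [psum_eq_sum, initialSet_self]

theorem notMem_initialSet {k : ℕ} (hk : k < d) : (⟨k, hk⟩ : Fin d) ∉ initialSet d k := by
  simp [mem_initialSet]

theorem initialSet_succ {k : ℕ} (hk : k < d) :
    initialSet d (k + 1) = Finset.cons ⟨k, hk⟩ (initialSet d k) (notMem_initialSet hk) := by
  ext i
  simp only [mem_initialSet, Finset.mem_cons, Fin.ext_iff]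
  omega

theorem psum_succ {M : Type*} [AddCommMonoid M] (v : Fin d → M) {k : ℕ} (hk : k < d) :
    psum v (k + 1) = psum v k + v ⟨k, hk⟩ := by
  rw [psum_eq_sum, psum_eq_sum, initialSet_succ hk, Finset.sum_cons, add_comm]

theorem psum_update_of_le (y : Fin d → ℕ) {i : Fin d} {k : ℕ} (h : k ≤ i.val) (c : ℕ) :
    psum (Function.update y i c) k = psum y k := by
  rw [psum_eq_sum, psum_eq_sum, Finset.sum_update_of_notMem]
  simp [mem_initialSet, h]

theorem psum_update_add (y : Fin d → ℕ) {i : Fin d} {k : ℕ} (h : i.val < k) (c : ℕ) :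
    psum (Function.update y i c) k + y i = psum y k + c := by
  have hi : i ∈ initialSet d k := mem_initialSet.2 h
  rw [psum_eq_sum, psum_eq_sum, Finset.sum_update_of_mem hi,
    ← Finset.sum_sdiff (Finset.singleton_subset_iff.2 hi), Finset.sum_singleton]
  omega

theorem psum_mono (y : Fin d → ℕ) {j k : ℕ} (h : j ≤ k) : psum y j ≤ psum y k :=
  Finset.sum_le_sum_of_subset fun i hi => by
    have := (Finset.mem_filter.1 hi).2
    simp; omega

/-- The factor with index `j` of the product defining `Psi`. -/
noncomputable def psiFactor (q : ℝ) (α : Fin d → ℝ) (n y : Fin d → ℕ) (j : Fin (d - 1)) : ℝ :=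
  hahnFun q (n ⟨j, by omega⟩) (((psum y (j + 1) : ℕ) : ℤ) - ((psum n j : ℕ) : ℤ))
    (2 * ((psum n j : ℕ) : ℝ) + psum α (j + 1) + j) (α ⟨j + 1, by omega⟩)
    (((psum y (j + 2) : ℕ) : ℤ) - ((psum n j : ℕ) : ℤ))

/-- The part of `Psi` that involves only the first `k` tensor factors. -/
noncomputable def partialPsi (q : ℝ) (α : Fin d → ℝ) (n y : Fin d → ℕ) (k : ℕ) : ℝ :=
  ∏ j : Fin (d - 1) with j.val + 1 < k, psiFactor q α n y j

/-- The part of `Psi` that involves only the sums over at least `k` tensor factors. -/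
noncomputable def tailPsi (q : ℝ) (α : Fin d → ℝ) (n y : Fin d → ℕ) (k : ℕ) : ℝ :=
  (if psum n d = psum y d then 1 else 0) *
    ∏ j : Fin (d - 1) with ¬ j.val + 1 < k, psiFactor q α n y j

variable (q : ℝ) (α : Fin d → ℝ)

theorem Psi_eq_partialPsi_mul (n y : Fin d → ℕ) (k : ℕ) :
    Psi q α n y = partialPsi q α n y k * tailPsi q α n y k := by
  rw [partialPsi, tailPsi, mul_left_comm, Finset.prod_filter_mul_prod_filter_not]
  rfl

theorem Psi_eq_partialPsi (n y : Fin d → ℕ) :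
    Psi q α n y = if psum n d = psum y d then partialPsi q α n y d else 0 := by
  have : partialPsi q α n y d = ∏ j, psiFactor q α n y j :=
    Finset.prod_congr (Finset.filter_true_of_mem fun j _ => by omega) fun _ _ => rfl
  rw [this, ← one_mul (∏ j, _), ← zero_mul (∏ j, psiFactor q α n y j), ← ite_mul]
  rfl

theorem partialPsi_one (n y : Fin d → ℕ) : partialPsi q α n y 1 = 1 := by
  rw [partialPsi, Finset.filter_false_of_mem (by omega), Finset.prod_empty]

theorem partialPsi_succ (n y : Fin d → ℕ) {j : ℕ} (hj : j < d - 1) :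
    partialPsi q α n y (j + 2) = partialPsi q α n y (j + 1) * psiFactor q α n y ⟨j, hj⟩ := by
  have : ({i : Fin (d - 1) | i.val + 1 < j + 2} : Finset _) =
      Finset.cons ⟨j, hj⟩ ({i : Fin (d - 1) | i.val + 1 < j + 1} : Finset _) (by simp) := by
    ext i
    simp only [Finset.mem_filter, Finset.mem_univ, true_and, Finset.mem_cons, Fin.ext_iff]
    omega
  rw [partialPsi, this, Finset.prod_cons, mul_comm]
  rfl

variable {q α}

theorem partialPsi_congr {n y y' : Fin d → ℕ} {k : ℕ} (h : ∀ m ≤ k, psum y m = psum y' m) :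
    partialPsi q α n y k = partialPsi q α n y' k := by
  refine Finset.prod_congr rfl fun j hj => ?_
  have hj := (Finset.mem_filter.1 hj).2
  rw [psiFactor, psiFactor, h _ (by omega), h _ (by omega)]

/-- The tail sees only the sums `Y_m` with `m ≥ k`, so it passes through operators on the first `k`
factors that preserve `Y_k`. -/
theorem tailPsi_congr {n y y' : Fin d → ℕ} {k : ℕ} (hk : k ≤ d)
    (h : ∀ m, k ≤ m → m ≤ d → psum y m = psum y' m) :
    tailPsi q α n y k = tailPsi q α n y' k := by
  rw [tailPsi, tailPsi, h d hk le_rfl]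
  congr 1
  refine Finset.prod_congr rfl fun j hj => ?_
  have hj := (Finset.mem_filter.1 hj).2
  rw [psiFactor, psiFactor, h _ (by omega) (by omega), h _ (by omega) (by omega)]

/-- The last factor has degree `n_j` greater than its size parameter. This makes the truncated level
`psum y (j + 1) - psum n j` harmless later on. -/
theorem partialPsi_eq_zero {n y : Fin d → ℕ} {j : ℕ} (hj : j < d) (h : psum y (j + 1) < psum n j) :
    partialPsi q α n y (j + 1) = 0 := by
  rcases j with _ | j
  · simp [psum_zero] at h
  · rw [partialPsi_succ q α n y (show j < d - 1 by omega), psiFactor]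
    rw [psum_succ n (show j < d by omega)] at h
    rw [hahnFun_eq_zero (Or.inr (Or.inr ?_)), mul_zero]
    change psum y (j + 2) < _ at h
    simp only
    omega

/-- The action of `A_+^S` on coefficient functions. -/
noncomputable def raiseFun (q : ℝ) (α : Fin d → ℝ) (S : Finset (Fin d))
    (f : (Fin d → ℕ) → ℝ) (y : Fin d → ℕ) : ℝ :=
  ∑ i ∈ S, q ^ (∑ l ∈ S with l < i, weight (α l) (y l)) * √(sigma q (α i) (y i)) *
    f (Function.update y i (y i - 1))

/-- The action of `A_-^S` on coefficient functions. -/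
noncomputable def lowerFun (q : ℝ) (α : Fin d → ℝ) (S : Finset (Fin d))
    (f : (Fin d → ℕ) → ℝ) (y : Fin d → ℕ) : ℝ :=
  ∑ i ∈ S, q ^ (∑ l ∈ S with l < i, weight (α l) (y l)) * √(sigma q (α i) (y i + 1)) *
    f (Function.update y i (y i + 1))

theorem sum_weight (α : Fin d → ℝ) (y : Fin d → ℕ) {k : ℕ} (hk : k ≤ d) :
    ∑ l ∈ initialSet d k, weight (α l) (y l) = (psum y k : ℕ) + (psum α k + k) / 2 := by
  have hc : (initialSet d k).card = k := by
    induction k with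
    | zero => simp [initialSet]
    | succ k ih => rw [initialSet_succ (by omega), Finset.card_cons, ih (by omega)]
  simp only [weight, Finset.sum_add_distrib, add_div, psum_eq_sum, Finset.sum_div, Nat.cast_sum,
    Finset.sum_const, hc, nsmul_eq_mul]
  ring

theorem filter_lt_initialSet_succ {k : ℕ} (hk : k < d) :
    ({l ∈ initialSet d (k + 1) | l < ⟨k, hk⟩} : Finset (Fin d)) = initialSet d k := by
  ext l
  simp only [Finset.mem_filter, mem_initialSet, Fin.lt_def]
  omega

theorem filter_lt_initialSet_succ_of_mem {k : ℕ} {i : Fin d} (hi : i ∈ initialSet d k) :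
    ({l ∈ initialSet d (k + 1) | l < i} : Finset (Fin d)) = {l ∈ initialSet d k | l < i} := by
  ext l
  simp only [Finset.mem_filter, mem_initialSet, Fin.lt_def] at hi ⊢
  omega

/-- The parameter of the irreducible constituent containing a partially coupled vector. -/
noncomputable def coupledParam (α : Fin d → ℝ) (n : Fin d → ℕ) (j : ℕ) : ℝ :=
  2 * ((psum n j : ℕ) : ℝ) + psum α (j + 1) + j

theorem coupledParam_pos (hα : ∀ i, 0 < α i) (n : Fin d → ℕ) {j : ℕ} (hj : j < d) :
    0 < coupledParam α n j := by
  have : 0 < psum α (j + 1) :=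
    Finset.sum_pos (fun i _ => hα i) ⟨⟨j, hj⟩, by simp⟩
  unfold coupledParam
  positivity

theorem coupledParam_succ (α : Fin d → ℝ) (n : Fin d → ℕ) {j : ℕ} (hj : j + 1 < d) :
    coupledParam α n (j + 1) =
      2 * (n ⟨j, by omega⟩ : ℝ) + coupledParam α n j + α ⟨j + 1, hj⟩ + 1 := by
  rw [coupledParam, coupledParam, psum_succ n (show j < d by omega), psum_succ α hj]
  push_cast
  ring

theorem psiFactor_eq (n y : Fin d → ℕ) {j : ℕ} (hj : j < d - 1) {x N : ℤ}
    (hx : ((psum y (j + 1) : ℕ) : ℤ) - ((psum n j : ℕ) : ℤ) = x)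
    (hN : ((psum y (j + 2) : ℕ) : ℤ) - ((psum n j : ℕ) : ℤ) = N) :
    psiFactor q α n y ⟨j, hj⟩ = hahnFun q (n ⟨j, by omega⟩) x (coupledParam α n j)
      (α ⟨j + 1, by omega⟩) N := by
  rw [← hx, ← hN]
  rfl

/-- The partially coupled vectors behave under `A_+^{[1;j+1]}` as basis vectors of `V^{(a)}` with `a
= coupledParam α n j`. The induction step is `hahnFun_raising_add` for this module and the next
tensor factor. -/
theorem raiseFun_partialPsi (hq0 : 0 < q) (hq1 : q < 1) (hα : ∀ i, 0 < α i) (n y : Fin d → ℕ)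
    {j : ℕ} (hj : j < d) :
    raiseFun q α (initialSet d (j + 1)) (fun z => partialPsi q α n z (j + 1)) y =
      √(sigma q (coupledParam α n j) (psum y (j + 1) - psum n j)) *
        partialPsi q α n y (j + 1) := by
  induction j with
  | zero =>
    rw [raiseFun, initialSet_succ hj, Finset.sum_cons]
    have e : initialSet d 0 = ∅ := by simp [initialSet]
    simp [partialPsi_one, coupledParam, psum_zero, psum_succ _ hj, e, Finset.filter_singleton]
  | succ j ih =>
    have ih := ih (by omega)
    have hj' : j < d - 1 := by omega
    set a := coupledParam α n j with ha
    have ha0 : 0 < a := coupledParam_pos hα n (by omega)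
    set k : Fin d := ⟨j + 1, hj⟩ with hk
    set x : ℤ := ((psum y (j + 1) : ℕ) : ℤ) - ((psum n j : ℕ) : ℤ) with hx
    have hN : ((psum y (j + 2) : ℕ) : ℤ) - ((psum n j : ℕ) : ℤ) = x + y k := by
      rw [psum_succ y hj]; push_cast; ring
    -- `A_+^{[1;j+2]} = A_+^{[1;j+1]} + q^{A_0^{[1;j+1]}} A_+^{(j+2)}`. Within the block, every site
    -- shifts `Y_{j+1}` alike, so the new `q`-Hahn factor comes out of the block sum; moving the
    -- last site leaves `partialPsi` of the block unchanged.
    have hsum : raiseFun q α (initialSet d (j + 1 + 1))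
        (fun z => partialPsi q α n z (j + 1 + 1)) y =
        raiseFun q α (initialSet d (j + 1)) (fun z => partialPsi q α n z (j + 1)) y *
          hahnFun q (n ⟨j, by omega⟩) (x - 1) a (α k) (x + y k - 1) +
        q ^ ((psum y (j + 1) : ℕ) + (psum α (j + 1) + (j + 1 : ℕ)) / 2 : ℝ) *
          √(sigma q (α k) (y k)) * (partialPsi q α n y (j + 1) *
          hahnFun q (n ⟨j, by omega⟩) x a (α k) (x + y k - 1)) := by
      rw [raiseFun, initialSet_succ hj, Finset.sum_cons, ← initialSet_succ hj,
        filter_lt_initialSet_succ hj, sum_weight α y (show j + 1 ≤ d by omega), add_comm,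
        raiseFun, Finset.sum_mul]
      congr 1
      · refine Finset.sum_congr rfl fun i hi => ?_
        rw [filter_lt_initialSet_succ_of_mem hi]
        rcases Nat.eq_zero_or_pos (y i) with h0 | h0
        · simp [h0, sigma_zero]
        have hi := mem_initialSet.1 hi
        have h1 := psum_update_add y hi (y i - 1)
        have h2 := psum_update_add y (show i.val < j + 2 by omega) (y i - 1)
        rw [partialPsi_succ q α n _ hj', psiFactor_eq n _ hj' (x := x - 1) (N := x + y k - 1)
          (by omega) (by omega)]
        ring
      · rcases Nat.eq_zero_or_pos (y k) with h0 | h0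
        · simp only [← hk, h0, sigma_zero, Real.sqrt_zero, mul_zero, zero_mul]
        have h1 := psum_update_of_le y (show j + 1 ≤ k.val from le_rfl) (y k - 1)
        have h2 := psum_update_add y (show k.val < j + 2 from Nat.lt_succ_self _) (y k - 1)
        rw [← hk, partialPsi_succ q α n _ hj', psiFactor_eq n _ hj' (x := x) (N := x + y k - 1)
          (by omega) (by omega), partialPsi_congr (y' := y)]
        intro m hm
        exact psum_update_of_le y hm _
    rw [hsum, ih, partialPsi_succ q α n y hj', psiFactor_eq n y hj' hx.symm hN]
    rcases Nat.lt_or_ge (psum y (j + 1)) (psum n j) with h | h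
    · rw [partialPsi_eq_zero (by omega) h]; simp
    obtain ⟨X, hX⟩ := Nat.exists_eq_add_of_le h
    have hxX : x = X := by omega
    have key := hahnFun_raising_add hq0 hq1 ha0 (hα k) (n ⟨j, by omega⟩) X (y k)
    have e1 : psum y (j + 1) - psum n j = X := by omega
    have e2 : psum y (j + 1 + 1) - psum n (j + 1) = X + y k - n ⟨j, by omega⟩ := by
      rw [psum_succ y hj, psum_succ n (show j < d by omega), ← hk]; omega
    have e3 : ((psum y (j + 1) : ℕ) + (psum α (j + 1) + (j + 1 : ℕ)) / 2 : ℝ) =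
        X + (a + 1) / 2 := by
      rw [ha, coupledParam, hX]; push_cast; ring
    rw [e1, e2, e3, coupledParam_succ α n hj, hxX, ← ha, ← hk]
    linear_combination partialPsi q α n y (j + 1) * key

theorem lowerFun_partialPsi (hq0 : 0 < q) (hq1 : q < 1) (hα : ∀ i, 0 < α i) (n y : Fin d → ℕ)
    {j : ℕ} (hj : j < d) :
    lowerFun q α (initialSet d (j + 1)) (fun z => partialPsi q α n z (j + 1)) y =
      √(sigma q (coupledParam α n j) (psum y (j + 1) - psum n j + 1)) *
        partialPsi q α n y (j + 1) := by
  induction j with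
  | zero =>
    rw [lowerFun, initialSet_succ hj, Finset.sum_cons]
    have e : initialSet d 0 = ∅ := by simp [initialSet]
    simp [partialPsi_one, coupledParam, psum_zero, psum_succ _ hj, e, Finset.filter_singleton]
  | succ j ih =>
    have ih := ih (by omega)
    have hj' : j < d - 1 := by omega
    set a := coupledParam α n j with ha
    have ha0 : 0 < a := coupledParam_pos hα n (by omega)
    set k : Fin d := ⟨j + 1, hj⟩ with hk
    set x : ℤ := ((psum y (j + 1) : ℕ) : ℤ) - ((psum n j : ℕ) : ℤ) with hx
    have hN : ((psum y (j + 2) : ℕ) : ℤ) - ((psum n j : ℕ) : ℤ) = x + y k := by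
      rw [psum_succ y hj]; push_cast; ring
    have hsum : lowerFun q α (initialSet d (j + 1 + 1))
        (fun z => partialPsi q α n z (j + 1 + 1)) y =
        lowerFun q α (initialSet d (j + 1)) (fun z => partialPsi q α n z (j + 1)) y *
          hahnFun q (n ⟨j, by omega⟩) (x + 1) a (α k) (x + y k + 1) +
        q ^ ((psum y (j + 1) : ℕ) + (psum α (j + 1) + (j + 1 : ℕ)) / 2 : ℝ) *
          √(sigma q (α k) (y k + 1)) * (partialPsi q α n y (j + 1) *
          hahnFun q (n ⟨j, by omega⟩) x a (α k) (x + y k + 1)) := by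
      rw [lowerFun, initialSet_succ hj, Finset.sum_cons, ← initialSet_succ hj,
        filter_lt_initialSet_succ hj, sum_weight α y (show j + 1 ≤ d by omega), add_comm,
        lowerFun, Finset.sum_mul]
      congr 1
      · refine Finset.sum_congr rfl fun i hi => ?_
        rw [filter_lt_initialSet_succ_of_mem hi]
        have hi := mem_initialSet.1 hi
        have h1 := psum_update_add y hi (y i + 1)
        have h2 := psum_update_add y (show i.val < j + 2 by omega) (y i + 1)
        rw [partialPsi_succ q α n _ hj', psiFactor_eq n _ hj' (x := x + 1) (N := x + y k + 1)
          (by omega) (by omega)]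
        ring
      · have h1 := psum_update_of_le y (show j + 1 ≤ k.val from le_rfl) (y k + 1)
        have h2 := psum_update_add y (show k.val < j + 2 from Nat.lt_succ_self _) (y k + 1)
        rw [← hk, partialPsi_succ q α n _ hj', psiFactor_eq n _ hj' (x := x) (N := x + y k + 1)
          (by omega) (by omega), partialPsi_congr (y' := y)]
        intro m hm
        exact psum_update_of_le y hm _
    rw [hsum, ih, partialPsi_succ q α n y hj', psiFactor_eq n y hj' hx.symm hN]
    rcases Nat.lt_or_ge (psum y (j + 1)) (psum n j) with h | h
    · rw [partialPsi_eq_zero (by omega) h]; simp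
    obtain ⟨X, hX⟩ := Nat.exists_eq_add_of_le h
    have hxX : x = X := by omega
    have key := hahnFun_lowering_add hq0 hq1 ha0 (hα k) (n ⟨j, by omega⟩) X (y k)
    have e1 : psum y (j + 1) - psum n j = X := by omega
    have e2 : psum y (j + 1 + 1) - psum n (j + 1) = X + y k - n ⟨j, by omega⟩ := by
      rw [psum_succ y hj, psum_succ n (show j < d by omega), ← hk]; omega
    have e3 : ((psum y (j + 1) : ℕ) + (psum α (j + 1) + (j + 1 : ℕ)) / 2 : ℝ) =
        X + (a + 1) / 2 := by
      rw [ha, coupledParam, hX]; push_cast; ring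
    rw [e1, e2, e3, coupledParam_succ α n hj, hxX, ← ha, ← hk]
    linear_combination partialPsi q α n y (j + 1) * key

end SuQ
namespace SuQ

/-! ### Casimir eigenvalues. -/

/-- This is the Casimir on one module `V^{(a)}` at level `X`, where `A_+A_-` has eigenvalue `σ_X`.
In `r = q^{1/2}`, `t = q^{a/2}`, `p = q^X` it is a rational identity, and the `p`-dependence
cancels. -/
theorem casimir_scalar {q : ℝ} (hq0 : 0 < q) (hq1 : q < 1) (a : ℝ) (X : ℕ) :
    ((q ^ (1 / 2 : ℝ) - q ^ (-1 / 2 : ℝ)) ^ 2)⁻¹ *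
      (q ^ (-1 / 2 : ℝ) * q ^ (1 * ((X : ℝ) + (a + 1) / 2))
        + q ^ (1 / 2 : ℝ) * q ^ (-1 * ((X : ℝ) + (a + 1) / 2)))
      - q * q ^ (-1 * ((X : ℝ) + (a + 1) / 2)) * sigma q a X = gam q a := by
  obtain ⟨r, hr⟩ : ∃ r, r = q ^ (1 / 2 : ℝ) := ⟨_, rfl⟩
  obtain ⟨t, ht⟩ : ∃ t, t = q ^ (a / 2) := ⟨_, rfl⟩
  obtain ⟨p, hp⟩ : ∃ p, p = q ^ X := ⟨_, rfl⟩
  have r0 : 0 < r := hr ▸ Real.rpow_pos_of_pos hq0 _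
  have t0 : 0 < t := ht ▸ Real.rpow_pos_of_pos hq0 _
  have p0 : 0 < p := hp ▸ pow_pos hq0 _
  have r1 : r < 1 := hr ▸ Real.rpow_lt_one hq0.le hq1 (by norm_num)
  have hqr : q = r ^ 2 := by
    rw [hr, ← Real.rpow_natCast, ← Real.rpow_mul hq0.le]; norm_num
  have e1 : q ^ (-1 / 2 : ℝ) = r⁻¹ := by rw [hr, ← Real.rpow_neg hq0.le]; norm_num
  have e2 : q ^ (-a / 2) = t⁻¹ := by rw [ht, ← Real.rpow_neg hq0.le]; congr 1; ring
  have e3 : q ^ (1 * ((X : ℝ) + (a + 1) / 2)) = p * t * r := by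
    rw [hp, ht, hr, ← Real.rpow_natCast, ← Real.rpow_add hq0, ← Real.rpow_add hq0]
    congr 1; ring
  have e4 : q ^ (-1 * ((X : ℝ) + (a + 1) / 2)) = (p * t * r)⁻¹ := by
    rw [← e3, ← Real.rpow_neg hq0.le]; congr 1; ring
  have e5 : sigma q a X = r * ((1 - p) * (1 - p * t ^ 2) / (1 - r ^ 2) ^ 2) := by
    have : q ^ ((X : ℝ) + a) = p * t ^ 2 := by
      rw [hp, ht, ← Real.rpow_natCast, ← Real.rpow_natCast, ← Real.rpow_mul hq0.le,
        ← Real.rpow_add hq0]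
      congr 1; push_cast; ring
    rw [sigma, this, ← hr, ← hp, ← hqr]
  rw [gam, e1, e2, e3, e4, e5, ← hr, ← ht, hqr]
  have hd : 1 - r ^ 2 ≠ 0 := by nlinarith
  have hd' : r - r⁻¹ = -(1 - r ^ 2) / r := by field_simp; ring
  rw [hd']
  generalize hD : 1 - r ^ 2 = D at *
  field_simp
  ring

variable {d : ℕ} {q : ℝ} {α : Fin d → ℝ}

theorem raiseFun_lowerFun_mul {S : Finset (Fin d)} {h f : (Fin d → ℕ) → ℝ} {y : Fin d → ℕ}
    (hh : ∀ i ∈ S, ∀ j ∈ S, 0 < y i → ∀ z, z = Function.update y i (y i - 1) →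
      h (Function.update z j (z j + 1)) = h y) :
    raiseFun q α S (lowerFun q α S fun z => h z * f z) y =
      h y * raiseFun q α S (lowerFun q α S f) y := by
  rw [raiseFun, raiseFun, Finset.mul_sum]
  refine Finset.sum_congr rfl fun i hi => ?_
  rcases Nat.eq_zero_or_pos (y i) with h0 | h0
  · simp [h0, sigma_zero]
  rw [mul_left_comm]
  congr 1
  rw [lowerFun, lowerFun, Finset.mul_sum]
  refine Finset.sum_congr rfl fun j hj => ?_
  rw [hh i hi j hj h0 _ rfl]
  ring

theorem raiseFun_lowerFun_partialPsi (hq0 : 0 < q) (hq1 : q < 1) (hα : ∀ i, 0 < α i)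
    (n y : Fin d → ℕ) {j : ℕ} (hj : j < d) :
    raiseFun q α (initialSet d (j + 1))
        (lowerFun q α (initialSet d (j + 1)) fun z => partialPsi q α n z (j + 1)) y =
      sigma q (coupledParam α n j) (psum y (j + 1) - psum n j) * partialPsi q α n y (j + 1) := by
  have h1 : lowerFun q α (initialSet d (j + 1)) (fun z => partialPsi q α n z (j + 1)) =
      fun z => √(sigma q (coupledParam α n j) (psum z (j + 1) - psum n j + 1)) *
        partialPsi q α n z (j + 1) :=
    funext fun z => lowerFun_partialPsi hq0 hq1 hα n z hj
  -- `A_+` reads its argument one level lower, so the level `X + 1` produced by `A_-` becomes `X`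
  -- and can be taken outside.
  have h2 : raiseFun q α (initialSet d (j + 1))
      (fun z => √(sigma q (coupledParam α n j) (psum z (j + 1) - psum n j + 1)) *
        partialPsi q α n z (j + 1)) y =
      √(sigma q (coupledParam α n j) (psum y (j + 1) - psum n j)) *
      raiseFun q α (initialSet d (j + 1)) (fun z => partialPsi q α n z (j + 1)) y := by
    rw [raiseFun, raiseFun, Finset.mul_sum]
    refine Finset.sum_congr rfl fun i hi => ?_
    rcases Nat.eq_zero_or_pos (y i) with h0 | h0
    · simp [h0, sigma_zero]
    have hs := psum_update_add y (mem_initialSet.1 hi) (y i - 1)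
    rcases Nat.lt_or_ge (psum (Function.update y i (y i - 1)) (j + 1)) (psum n j) with h | h
    · rw [partialPsi_eq_zero hj h]; simp
    · rw [show psum (Function.update y i (y i - 1)) (j + 1) - psum n j + 1 =
        psum y (j + 1) - psum n j by omega]
      ring
  rw [h1, h2, raiseFun_partialPsi hq0 hq1 hα n y hj, ← mul_assoc,
    Real.mul_self_sqrt (sigma_nonneg hq0 hq1 (coupledParam_pos hα n hj) _)]

/-- The action of `casimir` on coefficient functions. -/
noncomputable def casimirFun (q : ℝ) (α : Fin d → ℝ) (S : Finset (Fin d))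
    (f : (Fin d → ℕ) → ℝ) (y : Fin d → ℕ) : ℝ :=
  ((q ^ (1 / 2 : ℝ) - q ^ (-1 / 2 : ℝ)) ^ 2)⁻¹ *
      (q ^ (-1 / 2 : ℝ) * (q ^ (1 * ∑ l ∈ S, weight (α l) (y l)) * f y)
        + q ^ (1 / 2 : ℝ) * (q ^ (-1 * ∑ l ∈ S, weight (α l) (y l)) * f y))
    - raiseFun q α S
        (lowerFun q α S fun z => q * (q ^ (-1 * ∑ l ∈ S, weight (α l) (z l)) * f z)) y

/-- Both the tail of `Psi` and the scalar `q^{1-A_0}` depend on quantities that `A_+A_-` preserves,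
so they factor out and `casimir_scalar` applies to `partialPsi`. -/
theorem casimirFun_Psi (hq0 : 0 < q) (hq1 : q < 1) (hα : ∀ i, 0 < α i) (n y : Fin d → ℕ)
    {j : ℕ} (hj : j < d) :
    casimirFun q α (initialSet d (j + 1)) (Psi q α n) y =
      gam q (coupledParam α n j) * Psi q α n y := by
  have hw : ∀ z, ∑ l ∈ initialSet d (j + 1), weight (α l) (z l) =
      (psum z (j + 1) : ℕ) + (psum α (j + 1) + (j + 1 : ℕ)) / 2 := fun z => sum_weight α z hj
  simp only [casimirFun, hw]
  have hsplit : (fun z => q * (q ^ (-1 * (((psum z (j + 1) : ℕ) : ℝ) +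
        (psum α (j + 1) + (j + 1 : ℕ)) / 2)) * Psi q α n z)) =
      fun z => (q * q ^ (-1 * (((psum z (j + 1) : ℕ) : ℝ) + (psum α (j + 1) + (j + 1 : ℕ)) / 2)) *
        tailPsi q α n z (j + 1)) * partialPsi q α n z (j + 1) := by
    funext z
    rw [Psi_eq_partialPsi_mul q α n z (j + 1)]
    ring
  rw [hsplit, raiseFun_lowerFun_mul, raiseFun_lowerFun_partialPsi hq0 hq1 hα n y hj,
    Psi_eq_partialPsi_mul q α n y (j + 1)]
  · rcases Nat.lt_or_ge (psum y (j + 1)) (psum n j) with h | h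
    · rw [partialPsi_eq_zero hj h]; simp
    obtain ⟨X, hX⟩ := Nat.exists_eq_add_of_le h
    have e : ((psum y (j + 1) : ℕ) + (psum α (j + 1) + (j + 1 : ℕ)) / 2 : ℝ) =
        X + (coupledParam α n j + 1) / 2 := by
      rw [coupledParam, hX]; push_cast; ring
    rw [e, ← casimir_scalar hq0 hq1 _ X, show psum y (j + 1) - psum n j = X by omega]
    ring
  · rintro i hi k hk h0 z rfl
    have hps : ∀ m, j + 1 ≤ m → psum (Function.update (Function.update y i (y i - 1)) k
        (Function.update y i (y i - 1) k + 1)) m = psum y m := by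
      intro m hm
      have h1 := psum_update_add y ((mem_initialSet.1 hi).trans_le hm) (y i - 1)
      have h2 := psum_update_add (Function.update y i (y i - 1))
        ((mem_initialSet.1 hk).trans_le hm) (Function.update y i (y i - 1) k + 1)
      omega
    rw [hps _ le_rfl, tailPsi_congr hj fun m hm _ => hps m hm]

/-! ### Orthonormality of `Psi`. -/

theorem sum_piAntidiag_initialSet_succ {j : ℕ} (hj : j < d) (f : (Fin d → ℕ) → ℝ) (M : ℕ) :
    ∑ y ∈ Finset.piAntidiag (initialSet d (j + 1)) M, f y =
      ∑ b ∈ Finset.range (M + 1), ∑ y ∈ Finset.piAntidiag (initialSet d j) b,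
        f (y + fun t => if t = ⟨j, hj⟩ then M - b else 0) := by
  rw [initialSet_succ hj, Finset.piAntidiag_cons, Finset.sum_disjiUnion,
    ← Finset.Nat.sum_antidiagonal_swap,
    Finset.Nat.sum_antidiagonal_eq_sum_range_succ_mk]
  refine Finset.sum_congr rfl fun b _ => ?_
  rw [Finset.sum_map]
  rfl

theorem psum_of_mem_piAntidiag {k M : ℕ} {y : Fin d → ℕ}
    (hy : y ∈ Finset.piAntidiag (initialSet d k) M) : psum y k = M :=
  (Finset.mem_piAntidiag.1 hy).1

theorem psum_add_single {j : ℕ} (hj : j < d) (y : Fin d → ℕ) (c : ℕ) {m : ℕ} :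
    psum (y + fun t => if t = ⟨j, hj⟩ then c else 0) m =
      psum y m + if j < m then c else 0 := by
  simp only [psum_eq_sum, Pi.add_apply, Finset.sum_add_distrib, Finset.sum_ite_eq',
    mem_initialSet]

/-- Sums of products of `q`-Hahn functions, with the range of summation shifted. -/
theorem sum_hahnFun_sub {a b : ℝ} (hq0 : 0 < q) (hq1 : q < 1) (ha : 0 < a) (hb : 0 < b)
    (n m s M : ℕ) :
    ∑ x ∈ Finset.range (M + 1), (if s ≤ x then
        hahnFun q n ((x : ℤ) - s) a b ((M : ℤ) - s) * hahnFun q m ((x : ℤ) - s) a b ((M : ℤ) - s)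
        else 0) = if n = m ∧ s + n ≤ M then 1 else 0 := by
  rcases Nat.lt_or_ge M (s + n) with h | h
  · rw [if_neg (by omega)]
    refine Finset.sum_eq_zero fun x _ => ?_
    rw [hahnFun_eq_zero (n := n) (by omega)]
    simp
  obtain ⟨R, rfl⟩ := Nat.exists_eq_add_of_le (show s ≤ M by omega)
  rw [show s + R + 1 = s + (R + 1) by ring, Finset.sum_range_add, Finset.sum_eq_zero, zero_add]
  · have e : ∀ x : ℕ, ((s + x : ℕ) : ℤ) - s = x := fun x => by push_cast; ring
    simp only [e, Nat.le_add_right, if_true]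
    rcases Nat.lt_or_ge R m with hm | hm
    · rw [if_neg (by omega)]
      refine Finset.sum_eq_zero fun x _ => ?_
      rw [hahnFun_eq_zero (n := m) (by omega)]
      simp
    · rw [sum_hahnFun_mul hq0 hq1 ha hb (by omega) hm]
      simp only [h, and_true]
  · intro x hx
    have := Finset.mem_range.1 hx
    rw [if_neg (by omega)]

/-- For a fixed total `b` of the smaller block, the induction hypothesis yields the indicator of
agreement below `j` and of `N_j ≤ b`. What remains is a sum over `b`, which is `q`-Hahn
orthonormality shifted by `N_j`. -/
theorem sum_partialPsi_mul (hq0 : 0 < q) (hq1 : q < 1) (hα : ∀ i, 0 < α i) (n m : Fin d → ℕ)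
    {j : ℕ} (hj : j < d) (M : ℕ) :
    ∑ y ∈ Finset.piAntidiag (initialSet d (j + 1)) M,
        partialPsi q α n y (j + 1) * partialPsi q α m y (j + 1) =
      if (∀ i : Fin d, i.val < j → n i = m i) ∧ psum n j ≤ M then 1 else 0 := by
  induction j generalizing M with
  | zero =>
    rw [if_pos ⟨fun i hi => absurd hi (Nat.not_lt_zero _), by simp [psum_zero]⟩,
      sum_piAntidiag_initialSet_succ hj]
    have e : initialSet d 0 = ∅ := by simp [initialSet]
    rw [Finset.sum_range_succ']
    simp [partialPsi_one, e]
  | succ j ih =>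
    have hj' : j < d - 1 := by omega
    rw [sum_piAntidiag_initialSet_succ hj]
    have step : ∀ b ∈ Finset.range (M + 1), ∑ y ∈ Finset.piAntidiag (initialSet d (j + 1)) b,
        (partialPsi q α n (y + fun t => if t = ⟨j + 1, hj⟩ then M - b else 0) (j + 1 + 1) *
          partialPsi q α m (y + fun t => if t = ⟨j + 1, hj⟩ then M - b else 0) (j + 1 + 1)) =
        (if (∀ i : Fin d, i.val < j → n i = m i) ∧ psum n j ≤ b then 1 else 0) *
          (hahnFun q (n ⟨j, by omega⟩) ((b : ℤ) - (psum n j : ℕ)) (coupledParam α n j)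
            (α ⟨j + 1, hj⟩) ((M : ℤ) - (psum n j : ℕ)) *
          hahnFun q (m ⟨j, by omega⟩) ((b : ℤ) - (psum m j : ℕ)) (coupledParam α m j)
            (α ⟨j + 1, hj⟩) ((M : ℤ) - (psum m j : ℕ))) := by
      intro b hb
      rw [← ih (by omega), Finset.sum_mul]
      refine Finset.sum_congr rfl fun y hy => ?_
      have hb := Finset.mem_range.1 hb
      have hy := psum_of_mem_piAntidiag hy
      have hp : ∀ m, psum (y + fun t => if t = ⟨j + 1, hj⟩ then M - b else 0) m =
        psum y m + if j + 1 < m then M - b else 0 := fun m => psum_add_single hj y _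
      have h1 := hp (j + 1)
      have h2 := hp (j + 2)
      rw [if_neg (by omega)] at h1
      -- Members of `piAntidiag` are supported in the smaller block, so `y` is zero at the new site
      -- before `M - b` is added there.
      have h3 : psum y (j + 2) = psum y (j + 1) := by
        rw [psum_succ y hj, (show y ⟨j + 1, hj⟩ = 0 from ?_), add_zero]
        by_contra hne
        have := (Finset.mem_piAntidiag.1 ‹y ∈ _›).2 _ hne
        simp [mem_initialSet] at this
      rw [if_pos (by omega), h3] at h2
      have hc : ∀ n : Fin d → ℕ, partialPsi q α n
          (y + fun t => if t = ⟨j + 1, hj⟩ then M - b else 0) (j + 1 + 1) =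
          partialPsi q α n y (j + 1) *
          hahnFun q (n ⟨j, by omega⟩) ((b : ℤ) - (psum n j : ℕ)) (coupledParam α n j)
            (α ⟨j + 1, hj⟩) ((M : ℤ) - (psum n j : ℕ)) := by
        intro n
        rw [partialPsi_succ q α n _ hj', partialPsi_congr (y' := y),
          psiFactor_eq n _ hj' (x := (b : ℤ) - (psum n j : ℕ)) (N := (M : ℤ) - (psum n j : ℕ))
          (by omega) (by omega)]
        intro m hm
        rw [hp, if_neg (by omega), add_zero]
      rw [hc, hc]
      ring
    rw [Finset.sum_congr rfl step]
    by_cases hag : ∀ i : Fin d, i.val < j → n i = m i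
    · have hps : psum m j = psum n j :=
        Finset.sum_congr rfl fun i hi => (hag i (by simpa using hi)).symm
      have hcp : coupledParam α m j = coupledParam α n j := by
        rw [coupledParam, coupledParam, hps]
      have := sum_hahnFun_sub hq0 hq1 (coupledParam_pos hα n (show j < d by omega))
        (hα ⟨j + 1, hj⟩) (n ⟨j, by omega⟩) (m ⟨j, by omega⟩) (psum n j) M
      simp only [hps, hcp, ite_mul, one_mul, zero_mul]
      rw [Finset.sum_congr rfl fun x _ => if_congr (and_iff_right hag) rfl rfl, this, psum_succ n (show j < d by omega)]
      refine if_congr (and_congr_left fun _ => ⟨fun h i hi => ?_, fun h => h _ (by simp)⟩) rfl rfl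
      rcases Nat.lt_or_ge i.val j with h' | h'
      · exact hag i h'
      · rw [show i = ⟨j, Nat.lt_of_succ_lt hj⟩ from Fin.ext (by simp; omega)]
        exact h
    · rw [if_neg fun h => hag fun i hi => h.1 i (by omega)]
      refine Finset.sum_eq_zero fun b _ => ?_
      rw [if_neg fun h => hag h.1, zero_mul]

/-- Orthonormality of the rows of `Psi` in a fixed degree. -/
theorem sum_Psi_mul (hq0 : 0 < q) (hq1 : q < 1) (hd : 1 ≤ d) (hα : ∀ i, 0 < α i)
    {M : ℕ} {n m : Fin d → ℕ} (hn : psum n d = M) (hm : psum m d = M) :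
    ∑ y ∈ Finset.piAntidiag Finset.univ M, Psi q α n y * Psi q α m y = if n = m then 1 else 0 := by
  obtain ⟨j, rfl⟩ := Nat.exists_eq_add_of_le' hd
  have h := sum_partialPsi_mul hq0 hq1 hα n m (Nat.lt_succ_self j) M
  rw [← initialSet_self]
  have e : ∀ y ∈ Finset.piAntidiag (initialSet (j + 1) (j + 1)) M,
      Psi q α n y * Psi q α m y = partialPsi q α n y (j + 1) * partialPsi q α m y (j + 1) := by
    intro y hy
    have hy := psum_of_mem_piAntidiag hy
    rw [Psi_eq_partialPsi, Psi_eq_partialPsi, if_pos (by omega), if_pos (by omega)]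
  rw [Finset.sum_congr rfl e, h]
  -- `partialPsi` does not involve the last entry of the index; it is recovered from the common
  -- total `M`.
  refine if_congr ⟨fun h => ?_, ?_⟩ rfl rfl
  · have hps : psum m j = psum n j :=
      Finset.sum_congr rfl fun i hi => (h.1 i (by simpa using hi)).symm
    have h1 := psum_succ n (Nat.lt_succ_self j)
    have h2 := psum_succ m (Nat.lt_succ_self j)
    funext i
    rcases Nat.lt_or_ge i.val j with h' | h'
    · exact h.1 i h'
    · obtain rfl : i = ⟨j, Nat.lt_succ_self j⟩ := Fin.ext (by simp; omega)
      omega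
  · rintro rfl
    exact ⟨fun _ _ => rfl, hn ▸ psum_mono n (Nat.le_succ j)⟩

/-- Orthonormality of the columns of `Psi` in a fixed degree. -/
theorem sum_Psi_mul' (hq0 : 0 < q) (hq1 : q < 1) (hd : 1 ≤ d) (hα : ∀ i, 0 < α i)
    {M : ℕ} {y z : Fin d → ℕ} (hy : psum y d = M) (hz : psum z d = M) :
    ∑ n ∈ Finset.piAntidiag Finset.univ M, Psi q α n y * Psi q α n z = if y = z then 1 else 0 := by
  have row := fun {n m : Fin d → ℕ} => sum_Psi_mul hq0 hq1 hd hα (M := M) (n := n) (m := m)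
  have mem : ∀ v : Fin d → ℕ, v ∈ Finset.piAntidiag Finset.univ M ↔ psum v d = M := by
    intro v; simp [psum_self]
  generalize Finset.piAntidiag (Finset.univ : Finset (Fin d)) M = S at mem row
  let U : Matrix S S ℝ := Matrix.of fun n y => Psi q α n.1 y.1
  have hU : U * U.transpose = 1 := by
    ext n m
    rw [Matrix.mul_apply, Matrix.one_apply]
    simp only [Subtype.ext_iff]
    rw [← row ((mem _).1 n.2) ((mem _).1 m.2)]
    exact Finset.sum_coe_sort S fun y => Psi q α n.1 y * Psi q α m.1 y
  -- Rows and columns run over the same finite set, so a right inverse is a left inverse.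
  have hU' : U.transpose * U = 1 := mul_eq_one_comm.1 hU
  have h := congr_fun (congr_fun hU' ⟨y, (mem y).2 hy⟩) ⟨z, (mem z).2 hz⟩
  rw [Matrix.mul_apply, Matrix.one_apply] at h
  simp only [Subtype.mk.injEq] at h
  rw [← h]
  exact (Finset.sum_coe_sort S fun n => Psi q α n y * Psi q α n z).symm

end SuQ
namespace SuQ

/-! ### The operators in coordinates of the product basis. -/

variable {𝕜 : Type*} [RCLike 𝕜] {d : ℕ}

theorem site_prodBasis (k : Fin d) {T : Module.End 𝕜 (V 𝕜)} (y : Fin d → ℕ) {c : 𝕜} {m : ℕ}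
    (hT : T (Finsupp.single (y k) 1) = c • Finsupp.single m 1) :
    site 𝕜 k T (prodBasis 𝕜 d y) = c • prodBasis 𝕜 d (Function.update y k m) := by
  rw [prodBasis_apply, prodBasis_apply, site, PiTensorProduct.map_tprod]
  have h1 : (fun i => (Function.update (fun _ => LinearMap.id) k T : Fin d → Module.End 𝕜 (V 𝕜)) i
      (Finsupp.single (y i) 1 : V 𝕜)) =
      Function.update (fun i => (Finsupp.single (y i) 1 : V 𝕜)) k
        (c • (Finsupp.single m 1 : V 𝕜)) := by
    funext i
    rcases eq_or_ne i k with rfl | h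
    · simp only [Function.update_self, hT]
    · simp [Function.update_of_ne h]
  have h2 : (fun i => (Finsupp.single (Function.update y k m i) 1 : V 𝕜)) =
      Function.update (fun i => (Finsupp.single (y i) 1 : V 𝕜)) k (Finsupp.single m 1) := by
    funext i
    rcases eq_or_ne i k with rfl | h
    · simp
    · simp [Function.update_of_ne h]
  rw [h1, MultilinearMap.map_update_smul, h2]

theorem repr_prodBasis (y z : Fin d → ℕ) :
    (prodBasis 𝕜 d).repr (prodBasis 𝕜 d y) z = if y = z then 1 else 0 := by
  rw [Module.Basis.repr_self, Finsupp.single_apply]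

/-- The operators on single sites and the diagonal ones have at most one nonzero entry in each
matrix row, so a coordinate of `T v` is one coordinate of `v` times a scalar. -/
theorem repr_eq_of_forall_prodBasis {T : Module.End 𝕜 (W 𝕜 d)} {y z : Fin d → ℕ} {c : 𝕜}
    (h : ∀ x, (prodBasis 𝕜 d).repr (T (prodBasis 𝕜 d x)) y = if x = z then c else 0)
    (v : W 𝕜 d) : (prodBasis 𝕜 d).repr (T v) y = c * (prodBasis 𝕜 d).repr v z := by
  have : ((prodBasis 𝕜 d).coord y) ∘ₗ T = c • (prodBasis 𝕜 d).coord z := by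
    refine (prodBasis 𝕜 d).ext fun x => ?_
    simp only [LinearMap.comp_apply, Module.Basis.coord_apply, h, LinearMap.smul_apply,
      repr_prodBasis, smul_eq_mul, mul_ite, mul_one, mul_zero]
  exact LinearMap.congr_fun this v

theorem repr_site_Aplus (q a : ℝ) (k : Fin d) (v : W 𝕜 d) (y : Fin d → ℕ) :
    (prodBasis 𝕜 d).repr (site 𝕜 k (Aplus 𝕜 q a) v) y =
      ((√(sigma q a (y k)) : ℝ) : 𝕜) *
        (prodBasis 𝕜 d).repr v (Function.update y k (y k - 1)) := by
  refine repr_eq_of_forall_prodBasis (fun x => ?_) v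
  rw [site_prodBasis k x (c := ((√(sigma q a (x k + 1)) : ℝ) : 𝕜)) (m := x k + 1)
    (by simp [Aplus])]
  rw [map_smul, Finsupp.smul_apply, repr_prodBasis, smul_eq_mul, mul_ite, mul_one, mul_zero]
  split_ifs with h1 h2 h2
  · rw [← h1, Function.update_self]
  · exact absurd (by rw [← h1]; simp) h2
  · rcases Nat.eq_zero_or_pos (y k) with h0 | h0
    · rw [h0, sigma_zero]; simp
    · refine absurd ?_ h1
      rw [h2, Function.update_self, Function.update_idem, Nat.sub_add_cancel h0,
        Function.update_eq_self]
  · rfl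

theorem repr_site_Aminus (q a : ℝ) (k : Fin d) (v : W 𝕜 d) (y : Fin d → ℕ) :
    (prodBasis 𝕜 d).repr (site 𝕜 k (Aminus 𝕜 q a) v) y =
      ((√(sigma q a (y k + 1)) : ℝ) : 𝕜) *
        (prodBasis 𝕜 d).repr v (Function.update y k (y k + 1)) := by
  refine repr_eq_of_forall_prodBasis (fun x => ?_) v
  rw [site_prodBasis k x (c := ((√(sigma q a (x k)) : ℝ) : 𝕜)) (m := x k - 1)
    (by simp [Aminus])]
  rw [map_smul, Finsupp.smul_apply, repr_prodBasis, smul_eq_mul, mul_ite, mul_one, mul_zero]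
  rcases Nat.eq_zero_or_pos (x k) with h0 | h0
  · have : x ≠ Function.update y k (y k + 1) := fun h => by
      rw [h, Function.update_self] at h0; omega
    rw [if_neg this, h0, sigma_zero]; simp
  split_ifs with h1 h2 h2
  · rw [← h1, Function.update_self, Nat.sub_add_cancel h0]
  · refine absurd ?_ h2
    rw [← h1, Function.update_self, Function.update_idem, Nat.sub_add_cancel h0,
      Function.update_eq_self]
  · refine absurd ?_ h1
    rw [h2]; simp
  · rfl

theorem repr_qA0On (q : ℝ) (hq0 : 0 < q) (α : Fin d → ℝ) (S : Finset (Fin d)) (c : ℝ)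
    (v : W 𝕜 d) (y : Fin d → ℕ) :
    (prodBasis 𝕜 d).repr (qA0On 𝕜 q α S c v) y =
      ((q ^ (c * ∑ l ∈ S, weight (α l) (y l)) : ℝ) : 𝕜) * (prodBasis 𝕜 d).repr v y := by
  refine repr_eq_of_forall_prodBasis (fun x => ?_) v
  have h : qA0On 𝕜 q α S c (prodBasis 𝕜 d x) =
      ((q ^ (c * ∑ l ∈ S, weight (α l) (x l)) : ℝ) : 𝕜) • prodBasis 𝕜 d x := by
    rw [prodBasis_apply, qA0On, PiTensorProduct.map_tprod]
    have h1 : (fun i => (if i ∈ S then qA0 𝕜 q (α i) c else LinearMap.id)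
        (Finsupp.single (x i) 1 : V 𝕜)) =
        fun i => (if i ∈ S then ((q ^ (c * weight (α i) (x i)) : ℝ) : 𝕜) else 1) •
          (Finsupp.single (x i) 1 : V 𝕜) := by
      funext i
      split_ifs with hi
      · simp [qA0]
      · simp
    rw [h1, MultilinearMap.map_smul_univ, Finset.prod_ite_mem, Finset.univ_inter, Finset.mul_sum,
      Real.rpow_sum_of_pos hq0]
    push_cast
    rfl
  rw [h, map_smul, Finsupp.smul_apply, repr_prodBasis, smul_eq_mul, mul_ite, mul_one, mul_zero]
  split_ifs with h
  · rw [h]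
  · rfl

theorem repr_AplusOn {q : ℝ} (hq0 : 0 < q) {α : Fin d → ℝ} (S : Finset (Fin d)) {v : W 𝕜 d}
    {f : (Fin d → ℕ) → ℝ} (hv : ∀ y, (prodBasis 𝕜 d).repr v y = (f y : 𝕜)) (y : Fin d → ℕ) :
    (prodBasis 𝕜 d).repr (AplusOn 𝕜 q α S v) y = (raiseFun q α S f y : 𝕜) := by
  rw [AplusOn, LinearMap.sum_apply, map_sum, Finsupp.finsetSum_apply, raiseFun,
    RCLike.ofReal_sum]
  refine Finset.sum_congr rfl fun i _ => ?_
  rw [Module.End.mul_apply, repr_qA0On q hq0, repr_site_Aplus, hv, one_mul]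
  push_cast
  ring

theorem repr_AminusOn {q : ℝ} (hq0 : 0 < q) {α : Fin d → ℝ} (S : Finset (Fin d)) {v : W 𝕜 d}
    {f : (Fin d → ℕ) → ℝ} (hv : ∀ y, (prodBasis 𝕜 d).repr v y = (f y : 𝕜)) (y : Fin d → ℕ) :
    (prodBasis 𝕜 d).repr (AminusOn 𝕜 q α S v) y = (lowerFun q α S f y : 𝕜) := by
  rw [AminusOn, LinearMap.sum_apply, map_sum, Finsupp.finsetSum_apply, lowerFun,
    RCLike.ofReal_sum]
  refine Finset.sum_congr rfl fun i _ => ?_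
  rw [Module.End.mul_apply, repr_qA0On q hq0, repr_site_Aminus, hv, one_mul]
  push_cast
  ring

theorem repr_casimir {q : ℝ} (hq0 : 0 < q) {α : Fin d → ℝ} (S : Finset (Fin d)) {v : W 𝕜 d}
    {f : (Fin d → ℕ) → ℝ} (hv : ∀ y, (prodBasis 𝕜 d).repr v y = (f y : 𝕜)) (y : Fin d → ℕ) :
    (prodBasis 𝕜 d).repr (casimir 𝕜 q α S v) y = (casimirFun q α S f y : 𝕜) := by
  have h1 : ∀ z, (prodBasis 𝕜 d).repr (((q : 𝕜) • qA0On 𝕜 q α S (-1)) v) z =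
      ((q * (q ^ (-1 * ∑ l ∈ S, weight (α l) (z l)) * f z) : ℝ) : 𝕜) := by
    intro z
    rw [LinearMap.smul_apply, map_smul, Finsupp.smul_apply, repr_qA0On q hq0, hv]
    push_cast
    rw [smul_eq_mul]
  have h2 := repr_AplusOn hq0 (α := α) S (repr_AminusOn hq0 (α := α) S h1) y
  rw [casimir, casimirFun, LinearMap.add_apply, LinearMap.smul_apply, LinearMap.smul_apply,
    LinearMap.add_apply, LinearMap.smul_apply, LinearMap.smul_apply, Module.End.mul_apply,
    Module.End.mul_apply]
  simp only [map_add, map_smul, Finsupp.add_apply, Finsupp.smul_apply, h2, repr_qA0On q hq0, hv,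
    smul_eq_mul]
  push_cast
  ring

/-! ### The coupled basis given by `Psi`. -/

section Psi

variable {q : ℝ} {α : Fin d → ℝ}

theorem Psi_eq_zero {n y : Fin d → ℕ} (h : psum n d ≠ psum y d) : Psi q α n y = 0 := by
  rw [Psi, if_neg h, zero_mul]

theorem mem_piAntidiag_univ {v : Fin d → ℕ} {M : ℕ} :
    v ∈ Finset.piAntidiag Finset.univ M ↔ psum v d = M := by
  simp [psum_self]

theorem finsum_Psi_right {E : Type*} [AddCommMonoid E] (n : Fin d → ℕ) {f : (Fin d → ℕ) → E}
    (hf : ∀ y, Psi q α n y = 0 → f y = 0) :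
    ∑ᶠ y, f y = ∑ y ∈ Finset.piAntidiag Finset.univ (psum n d), f y := by
  refine finsum_eq_sum_of_support_subset _ fun y hy => ?_
  by_contra h
  exact hy (hf y (Psi_eq_zero fun h' => h (mem_piAntidiag_univ.2 h'.symm)))

theorem finsum_Psi_left {E : Type*} [AddCommMonoid E] (y : Fin d → ℕ) {f : (Fin d → ℕ) → E}
    (hf : ∀ n, Psi q α n y = 0 → f n = 0) :
    ∑ᶠ n, f n = ∑ n ∈ Finset.piAntidiag Finset.univ (psum y d), f n := by
  refine finsum_eq_sum_of_support_subset _ fun n hn => ?_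
  by_contra h
  exact hn (hf n (Psi_eq_zero fun h' => h (mem_piAntidiag_univ.2 h')))

theorem sum_Psi_mul_eq (hq0 : 0 < q) (hq1 : q < 1) (hd : 1 ≤ d) (hα : ∀ i, 0 < α i)
    (n m : Fin d → ℕ) :
    ∑ y ∈ Finset.piAntidiag Finset.univ (psum n d), Psi q α n y * Psi q α m y =
      if n = m then 1 else 0 := by
  rcases eq_or_ne (psum m d) (psum n d) with h | h
  · exact sum_Psi_mul hq0 hq1 hd hα rfl h
  · rw [if_neg fun e => h (by rw [e])]
    refine Finset.sum_eq_zero fun y hy => ?_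
    rw [Psi_eq_zero (n := m) (by rwa [mem_piAntidiag_univ.1 hy]), mul_zero]

theorem sum_Psi_mul_eq' (hq0 : 0 < q) (hq1 : q < 1) (hd : 1 ≤ d) (hα : ∀ i, 0 < α i)
    (y z : Fin d → ℕ) :
    ∑ n ∈ Finset.piAntidiag Finset.univ (psum y d), Psi q α n y * Psi q α n z =
      if y = z then 1 else 0 := by
  rcases eq_or_ne (psum z d) (psum y d) with h | h
  · exact sum_Psi_mul' hq0 hq1 hd hα rfl h
  · rw [if_neg fun e => h (by rw [e])]
    refine Finset.sum_eq_zero fun n hn => ?_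
    rw [Psi_eq_zero (y := z) (by rw [mem_piAntidiag_univ.1 hn]; exact h.symm), mul_zero]

variable (𝕜 q α) in
/-- The coupled basis with coefficients `Psi`. -/
noncomputable def psiVec (n : Fin d → ℕ) : W 𝕜 d :=
  (prodBasis 𝕜 d).repr.symm (Finsupp.onFinset (Finset.piAntidiag Finset.univ (psum n d))
    (fun y => (Psi q α n y : 𝕜)) fun y hy => by
      by_contra h
      refine hy ?_
      rw [Psi_eq_zero fun h' => h (mem_piAntidiag_univ.2 h'.symm), RCLike.ofReal_zero])

theorem repr_psiVec (n y : Fin d → ℕ) :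
    (prodBasis 𝕜 d).repr (psiVec 𝕜 q α n) y = (Psi q α n y : 𝕜) := by
  rw [psiVec, LinearEquiv.apply_symm_apply, Finsupp.onFinset_apply]

theorem innerW_psiVec (hq0 : 0 < q) (hq1 : q < 1) (hd : 1 ≤ d) (hα : ∀ i, 0 < α i)
    (n m : Fin d → ℕ) :
    innerW (psiVec 𝕜 q α n) (psiVec 𝕜 q α m) = if n = m then 1 else 0 := by
  rw [innerW, Finsupp.sum_of_support_subset (s := Finset.piAntidiag Finset.univ (psum n d))]
  · simp only [repr_psiVec, RCLike.conj_ofReal, ← RCLike.ofReal_mul]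
    rw [← RCLike.ofReal_sum, sum_Psi_mul_eq hq0 hq1 hd hα]
    split_ifs <;> simp
  · intro y hy
    rw [Finsupp.mem_support_iff, repr_psiVec] at hy
    by_contra h
    exact hy (by rw [Psi_eq_zero fun h' => h (mem_piAntidiag_univ.2 h'.symm), RCLike.ofReal_zero])
  · simp

theorem hasPsiExpansions_psiVec (hq0 : 0 < q) (hq1 : q < 1) (hd : 1 ≤ d) (hα : ∀ i, 0 < α i) :
    HasPsiExpansions q α (psiVec 𝕜 q α) := by
  constructor
  · intro n
    rw [finsum_Psi_right (q := q) (α := α) n fun y hy => by rw [hy, RCLike.ofReal_zero, zero_smul]]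
    refine (prodBasis 𝕜 d).ext_elem fun z => ?_
    rw [repr_psiVec, map_sum, Finsupp.finsetSum_apply]
    simp only [map_smul, Finsupp.smul_apply, repr_prodBasis, smul_eq_mul, mul_ite, mul_one,
      mul_zero, Finset.sum_ite_eq', mem_piAntidiag_univ]
    split_ifs with h
    · rfl
    · rw [Psi_eq_zero fun h' => h h'.symm, RCLike.ofReal_zero]
  · intro y
    rw [finsum_Psi_left (q := q) (α := α) y fun n hn => by rw [hn, RCLike.ofReal_zero, zero_smul]]
    refine (prodBasis 𝕜 d).ext_elem fun z => ?_
    rw [repr_prodBasis, map_sum, Finsupp.finsetSum_apply]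
    simp only [map_smul, Finsupp.smul_apply, repr_psiVec, smul_eq_mul, ← RCLike.ofReal_mul]
    rw [← RCLike.ofReal_sum, sum_Psi_mul_eq' hq0 hq1 hd hα]
    split_ifs <;> simp

theorem isCoupledBasis_psiVec (hq0 : 0 < q) (hq1 : q < 1) (hd : 1 ≤ d) (hα : ∀ i, 0 < α i) :
    IsCoupledBasis q α (psiVec 𝕜 q α) where
  orthonormal := innerW_psiVec hq0 hq1 hd hα
  span_eq_top := by
    rw [eq_top_iff, ← (prodBasis 𝕜 d).span_eq, Submodule.span_le]
    rintro _ ⟨y, rfl⟩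
    rw [(hasPsiExpansions_psiVec hq0 hq1 hd hα).2 y,
      finsum_Psi_left (q := q) (α := α) y fun n hn => by rw [hn, RCLike.ofReal_zero, zero_smul]]
    exact Submodule.sum_mem _ fun n _ =>
      Submodule.smul_mem _ _ (Submodule.subset_span (Set.mem_range_self n))
  casimir_eigen := by
    intro n k hk
    obtain ⟨hk2, hkd⟩ := Finset.mem_Icc.1 hk
    obtain ⟨j, rfl⟩ : ∃ j, k = j + 1 := ⟨k - 1, by omega⟩
    have hc : 2 * ((psum n (j + 1 - 1) : ℕ) : ℝ) + psum α (j + 1) + (j + 1 : ℕ) - 1 =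
        coupledParam α n j := by
      rw [coupledParam, Nat.add_sub_cancel]; push_cast; ring
    rw [hc]
    refine (prodBasis 𝕜 d).ext_elem fun y => ?_
    rw [repr_casimir hq0 _ (repr_psiVec n), casimirFun_Psi hq0 hq1 hα n y (by omega), map_smul,
      Finsupp.smul_apply, repr_psiVec, RCLike.ofReal_mul, smul_eq_mul]
  qA0_eigen := by
    intro n
    refine (prodBasis 𝕜 d).ext_elem fun y => ?_
    rw [repr_qA0On q hq0, map_smul, Finsupp.smul_apply, repr_psiVec, sum_weight α y le_rfl,
      smul_eq_mul, one_mul]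
    rcases eq_or_ne (psum n d) (psum y d) with h | h
    · rw [h]
    · rw [Psi_eq_zero h]; simp

end Psi

/-! ### Uniqueness up to phases. -/

/-- With `t = q^{a/2}`, the eigenvalue is a multiple of `t + t⁻¹`, which is injective on `0 < t <
1`; positivity of the parameters keeps `t` there. -/
theorem gam_injOn {q : ℝ} (hq0 : 0 < q) (hq1 : q < 1) {a b : ℝ} (ha : 0 < a) (hb : 0 < b)
    (h : gam q a = gam q b) : a = b := by
  have hne : q ^ (1 / 2 : ℝ) - q ^ (-1 / 2 : ℝ) ≠ 0 := by
    refine (sub_neg.2 ?_).ne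
    exact Real.rpow_lt_rpow_of_exponent_gt hq0 hq1 (by norm_num)
  have h1 : ∀ c : ℝ, q ^ (-c / 2) = (q ^ (c / 2))⁻¹ := fun c => by
    rw [← Real.rpow_neg hq0.le]; congr 1; ring
  rw [gam, gam, div_left_inj' (pow_ne_zero 2 hne), h1, h1] at h
  have ht : ∀ c : ℝ, 0 < c → 0 < q ^ (c / 2) ∧ q ^ (c / 2) < 1 := fun c hc =>
    ⟨Real.rpow_pos_of_pos hq0 _, Real.rpow_lt_one hq0.le hq1 (by positivity)⟩
  obtain ⟨s0, s1⟩ := ht a ha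
  obtain ⟨t0, t1⟩ := ht b hb
  have hst : q ^ (a / 2) = q ^ (b / 2) := by
    generalize q ^ (a / 2) = s at *
    generalize q ^ (b / 2) = t at *
    field_simp at h
    have h2 : (s - t) * (s * t - 1) = 0 := by linear_combination h
    rcases mul_eq_zero.1 h2 with h3 | h3
    · linarith
    · nlinarith
  have := (Real.rpow_right_inj hq0 hq1.ne).1 hst
  linarith

/-- The eigenvalues of the commuting operators determine the index of a coupled vector. -/
theorem eq_of_eigenvalues_eq {q : ℝ} (hq0 : 0 < q) (hq1 : q < 1) {α : Fin d → ℝ}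
    (hα : ∀ i, 0 < α i) {n m : Fin d → ℕ}
    (h1 : ∀ k ∈ Finset.Icc 2 d, gam q (2 * ((psum n (k - 1) : ℕ) : ℝ) + psum α k + k - 1) =
      gam q (2 * ((psum m (k - 1) : ℕ) : ℝ) + psum α k + k - 1))
    (h2 : q ^ (((psum n d : ℕ) : ℝ) + (psum α d + d) / 2) =
      q ^ (((psum m d : ℕ) : ℝ) + (psum α d + d) / 2)) : n = m := by
  have hd : psum n d = psum m d := by
    have := (Real.rpow_right_inj hq0 hq1.ne).1 h2
    exact_mod_cast add_right_cancel this
  have hp : ∀ j ≤ d, psum n j = psum m j := by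
    intro j hj
    rcases Nat.eq_zero_or_pos j with rfl | hj0
    · rw [psum_zero, psum_zero]
    rcases hj.eq_or_lt with rfl | hjd
    · exact hd
    -- The Casimir for `k = j + 1` detects the partial sum over `j` entries, so `2 ≤ k ≤ d` covers
    -- `1 ≤ j ≤ d - 1`; the total comes from `q^{A_0}`.
    have h := h1 (j + 1) (Finset.mem_Icc.2 ⟨by omega, by omega⟩)
    have hc : ∀ n : Fin d → ℕ, 2 * ((psum n (j + 1 - 1) : ℕ) : ℝ) + psum α (j + 1) +
        (j + 1 : ℕ) - 1 = coupledParam α n j := fun n => by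
      rw [coupledParam, Nat.add_sub_cancel]; push_cast; ring
    rw [hc, hc] at h
    have := gam_injOn hq0 hq1 (coupledParam_pos hα n hjd) (coupledParam_pos hα m hjd) h
    rw [coupledParam, coupledParam] at this
    have : ((psum n j : ℕ) : ℝ) = (psum m j : ℕ) := by linarith
    exact_mod_cast this
  funext i
  have e1 := hp i i.2.le
  have e2 := hp (i + 1) i.2
  rw [psum_succ n i.2, psum_succ m i.2] at e2
  simp only [Fin.eta] at e2
  omega

theorem repr_eq_zero_of_eigen {ι E : Type*} [AddCommMonoid E] [Module 𝕜 E]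
    (b : Module.Basis ι 𝕜 E) {T : Module.End 𝕜 E} {l : ι → 𝕜} (hT : ∀ i, T (b i) = l i • b i)
    {v : E} {c : 𝕜} (hv : T v = c • v) {i : ι} (hi : l i ≠ c) : b.repr v i = 0 := by
  have h : (b.coord i) ∘ₗ T = l i • b.coord i := by
    refine b.ext fun j => ?_
    simp only [LinearMap.comp_apply, hT, map_smul, LinearMap.smul_apply, Module.Basis.coord_apply,
      Module.Basis.repr_self, smul_eq_mul]
    rcases eq_or_ne j i with rfl | h
    · rfl
    · rw [Finsupp.single_eq_of_ne h.symm, mul_zero, mul_zero]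
  have h1 : b.repr (T v) i = l i * b.repr v i := LinearMap.congr_fun h v
  rw [hv, map_smul, Finsupp.smul_apply, smul_eq_mul] at h1
  have h2 : (l i - c) * b.repr v i = 0 := by linear_combination -h1
  exact (mul_eq_zero.1 h2).resolve_left (sub_ne_zero.2 hi)

/-- Pairing with the rows of `Psi` gives dual functionals, by row orthonormality. -/
theorem linearIndependent_psiVec {q : ℝ} (hq0 : 0 < q) (hq1 : q < 1) (hd : 1 ≤ d)
    {α : Fin d → ℝ} (hα : ∀ i, 0 < α i) : LinearIndependent 𝕜 (psiVec 𝕜 q α) := by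
  let φ : (Fin d → ℕ) → Module.Dual 𝕜 (W 𝕜 d) := fun n =>
    ∑ y ∈ Finset.piAntidiag Finset.univ (psum n d), (Psi q α n y : 𝕜) • (prodBasis 𝕜 d).coord y
  have hφ : ∀ n m, φ n (psiVec 𝕜 q α m) = if n = m then 1 else 0 := by
    intro n m
    simp only [φ, LinearMap.sum_apply, LinearMap.smul_apply, Module.Basis.coord_apply, repr_psiVec,
      smul_eq_mul, ← RCLike.ofReal_mul]
    rw [← RCLike.ofReal_sum, sum_Psi_mul_eq hq0 hq1 hd hα]
    split_ifs <;> simp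
  refine LinearIndependent.of_pairwise_dual_eq_zero_one (psiVec 𝕜 q α) φ ?_ ?_
  · intro n m h
    rw [hφ, if_neg h]
  · intro n
    rw [hφ, if_pos rfl]

theorem innerW_smul_smul (c : 𝕜) (u : W 𝕜 d) :
    innerW (c • u) (c • u) = conj c * c * innerW u u := by
  rw [innerW, innerW, map_smul, Finsupp.sum_smul_index (by simp), Finsupp.mul_sum]
  refine Finsupp.sum_congr fun y _ => ?_
  rw [map_mul, Finsupp.smul_apply, smul_eq_mul]
  ring

/-- A coupled basis is unique up to phases. -/
theorem IsCoupledBasis.exists_eq_smul_psiVec {q : ℝ} (hq0 : 0 < q) (hq1 : q < 1) (hd : 1 ≤ d)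
    {α : Fin d → ℝ} (hα : ∀ i, 0 < α i) {g : (Fin d → ℕ) → W 𝕜 d} (hg : IsCoupledBasis q α g)
    (m : Fin d → ℕ) : ∃ c : 𝕜, ‖c‖ = 1 ∧ g m = c • psiVec 𝕜 q α m := by
  have hΨ := isCoupledBasis_psiVec (𝕜 := 𝕜) hq0 hq1 hd hα
  let b : Module.Basis (Fin d → ℕ) 𝕜 (W 𝕜 d) :=
    Module.Basis.mk (linearIndependent_psiVec hq0 hq1 hd hα) hΨ.span_eq_top.ge
  have hb : ∀ n, b n = psiVec 𝕜 q α n := fun n => Module.Basis.mk_apply _ _ n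
  -- A nonzero coordinate at `n` forces all eigenvalues at `n` to equal those at `m`, and hence `n =
  -- m`.
  have hz : ∀ n, n ≠ m → b.repr (g m) n = 0 := by
    intro n hn
    by_contra hne
    refine hn (eq_of_eigenvalues_eq hq0 hq1 hα (fun k hk => ?_) ?_)
    · by_contra h
      have he := fun i => hΨ.casimir_eigen i k hk
      simp only [← hb] at he
      have hz := repr_eq_zero_of_eigen b (i := n) he (hg.casimir_eigen m k hk)
      exact hne (hz fun e => h (RCLike.ofReal_injective e))
    · by_contra h
      have he := hΨ.qA0_eigen
      simp only [← hb] at he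
      have hz := repr_eq_zero_of_eigen b (i := n) he (hg.qA0_eigen m)
      exact hne (hz fun e => h (RCLike.ofReal_injective e))
  have hgm : g m = b.repr (g m) m • psiVec 𝕜 q α m := by
    refine b.ext_elem fun n => ?_
    rw [map_smul, Finsupp.smul_apply, ← hb, Module.Basis.repr_self, Finsupp.single_apply,
      smul_eq_mul]
    split_ifs with h
    · rw [h, mul_one]
    · rw [hz n fun h' => h h'.symm, mul_zero]
  refine ⟨b.repr (g m) m, ?_, hgm⟩
  have h := hg.orthonormal m m
  rw [hgm, innerW_smul_smul, hΨ.orthonormal m m, if_pos rfl, mul_one, RCLike.conj_mul] at h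
  have h2 : ‖b.repr (g m) m‖ ^ 2 = 1 := by exact_mod_cast h
  exact (pow_eq_one_iff_of_nonneg (norm_nonneg _) two_ne_zero).1 h2

end SuQ

theorem proposition1 (𝕜 : Type*) [RCLike 𝕜] (q : ℝ) (hq0 : 0 < q) (hq1 : q < 1)
    (d : ℕ) (hd : 1 ≤ d) (α : Fin d → ℝ) (hα : ∀ i, 0 < α i) :
    -- all the sums below have finitely many nonzero terms
    (∀ n, {y | SuQ.Psi q α n y ≠ 0}.Finite) ∧
    (∀ y, {n | SuQ.Psi q α n y ≠ 0}.Finite) ∧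
    -- orthogonality relations
    (∀ n n', ∑ᶠ y, SuQ.Psi q α n y * SuQ.Psi q α n' y = if n = n' then 1 else 0) ∧
    (∀ y y', ∑ᶠ n, SuQ.Psi q α n y * SuQ.Psi q α n y' = if y = y' then 1 else 0) ∧
    -- a coupled basis with the expansion formulas exists
    (∃ g : (Fin d → ℕ) → SuQ.W 𝕜 d,
      SuQ.IsCoupledBasis q α g ∧ SuQ.HasPsiExpansions q α g) ∧
    -- every coupled basis is that one, up to the free choice of a phase of each vector
    (∀ g : (Fin d → ℕ) → SuQ.W 𝕜 d, SuQ.IsCoupledBasis q α g →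
      ∃ ε : (Fin d → ℕ) → 𝕜, (∀ n, ‖ε n‖ = 1) ∧
        SuQ.HasPsiExpansions q α fun n => ε n • g n) := by
  refine ⟨fun n => ?_, fun y => ?_, fun n m => ?_, fun y z => ?_, ?_, fun g hg => ?_⟩
  · refine (Finset.piAntidiag Finset.univ (SuQ.psum n d)).finite_toSet.subset fun y hy => ?_
    by_contra h
    exact hy (SuQ.Psi_eq_zero fun h' => h (SuQ.mem_piAntidiag_univ.2 h'.symm))
  · refine (Finset.piAntidiag Finset.univ (SuQ.psum y d)).finite_toSet.subset fun n hn => ?_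
    by_contra h
    exact hn (SuQ.Psi_eq_zero fun h' => h (SuQ.mem_piAntidiag_univ.2 h'))
  · rw [SuQ.finsum_Psi_right (q := q) (α := α) n fun y hy => by rw [hy, zero_mul],
      SuQ.sum_Psi_mul_eq hq0 hq1 hd hα]
  · rw [SuQ.finsum_Psi_left (q := q) (α := α) y fun n hn => by rw [hn, zero_mul],
      SuQ.sum_Psi_mul_eq' hq0 hq1 hd hα]
  · exact ⟨SuQ.psiVec 𝕜 q α, SuQ.isCoupledBasis_psiVec hq0 hq1 hd hα,
      SuQ.hasPsiExpansions_psiVec hq0 hq1 hd hα⟩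
  · choose c hc1 hc using fun m => hg.exists_eq_smul_psiVec hq0 hq1 hd hα m
    refine ⟨fun n => (c n)⁻¹, fun n => by rw [norm_inv, hc1, inv_one], ?_⟩
    have : (fun n => (c n)⁻¹ • g n) = SuQ.psiVec 𝕜 q α := by
      funext n
      have h0 : c n ≠ 0 := norm_ne_zero_iff.1 (by rw [hc1]; exact one_ne_zero)
      rw [hc, inv_smul_smul₀ h0]
    rw [this]
    exact SuQ.hasPsiExpansions_psiVec hq0 hq1 hd hα
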